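/- Let $A$ be a small Reedy category: a small category with two wide subcategories $A^{\to}$ and $A^{\gets}$ for which there is an ordinal-valued degree function on the objects such that nonidentity maps of $A^{\to}$ strictly raise the degree, nonidentity maps of $A^{\gets}$ strictly lower it, and such that every map of $A$ factors uniquely as a map of $A^{\gets}$ followed by a map of $A^{\to}$. The opposite $A^{\mathrm{op}}$ (with $(A^{\mathrm{op}})^{\to}=(A^{\gets})^{\mathrm{op}}$ and $(A^{\mathrm{op}})^{\gets}=(A^{\to})^{\mathrm{op}}$) and the product $A\times A$ (componentwise) are again Reedy categories. For a Reedy category $J$ and a complete and cocomplete (locally small) model category $M$, the functor category $M^{J}$ carries the Reedy weak equivalences (the objectwise ones) and the Reedy cofibrations: the maps $X\to Y$ such that for every $\alpha\in J$ the relative latching map $X_\alpha\sqcup_{L_\alpha X}L_\alpha Y\to Y_\alpha$ is a cofibration of $M$, where $L_\alpha X$ is the colimit of $X_\beta$ over the category of nonidentity maps $\beta\to\alpha$ of $J^{\to}$ (a full subcategory of $J^{\to}/\alpha$). Write $M(A)$ for the category $M^{A^{\mathrm{op}}}$ of $M$-valued presheaves on $A$ with its Reedy model structure. A functor $f:A\to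 B$ between small Reedy categories is a right fibration if $f(A^{\to})\subseteq B^{\to}$, $f(A^{\gets})\subseteq B^{\gets}$, and, for every complete and cocomplete model category $N$, the adjunction $f^{\star}: N^{B}\rightleftarrows N^{A}: f_{\star}$ between restriction and right Kan extension is a Quillen adjunction for the Reedy model structures, that is, $f^{\star}$ preserves Reedy cofibrations and Reedy trivial cofibrations. Suppose that $A$ is moreover equipped with a monoidal structure whose product $\circ: A\times A\to A$ is a right fibration of Reedy categories. Let $M$ be a complete and cocomplete symmetric monoidal model category (closed symmetric monoidal, satisfying the pushout-product and unit axioms). For $X,Y\in M(A)$ let $X\boxtimes Y\in M(A\times A)$ be the exterior product $(X\boxtimes Y)_{(\alpha,\alpha')}=X_\alpha\otimes Y_{\alpha'}$, and let $\circ_!: M(A\times A)\to M(A)$ be left Kan extension along $\circ^{\mathrm{op}}$. Then the Day convolution product $$(X,Y)\longmapsto X\circledast Y:=\circ_!(X\boxtimes Y)$$ is part of a Quillen adjunction of two variables on $M(A)$. That is, there are functors $G,H: M(A)^{\mathrm{op}}\times M(A)\to M(A)$ and isomorphisms $$\mathrm{Hom}(X\circledast Y,Z)\cong \mathrm{Hom}(Y,G(X,Z))\cong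 \mathrm{Hom}(X,H(Y,Z))$$ natural in $X,Y,Z$; and for all Reedy cofibrations $i:X_1\to Y_1$ and $j:X_2\to Y_2$ of $M(A)$ the pushout-product $$(Y_1\circledast X_2)\sqcup_{X_1\circledast X_2}(X_1\circledast Y_2)\longrightarrow Y_1\circledast Y_2$$ is a Reedy cofibration, which is a weak equivalence if $i$ or $j$ is one. -/

import Mathlib

open CategoryTheory Limits MonoidalCategory HomotopicalAlgebra Opposite

universe w u

/-! ### Reedy categories -/

/-- A Reedy category: a small category with two wide subcategories, `inv` (the degree-lowering
maps) and `dir` (the degree-raising maps), for which there exists an ordinal-valued degree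
function such that nonidentity maps of `inv` (resp. `dir`) strictly lower (resp. raise) the
degree, and such that every map factors uniquely as a map of `inv` followed by a map of `dir`. -/
class ReedyCategory (A : Type u) [SmallCategory A] where
  /-- The inverse (degree-lowering) part. -/
  inv : MorphismProperty A
  /-- The direct (degree-raising) part. -/
  dir : MorphismProperty A
  inv_isMultiplicative : inv.IsMultiplicative
  dir_isMultiplicative : dir.IsMultiplicative
  nonempty_reedyStructure : Nonempty (ReedyStructure inv dir Ordinal.{u})

namespace ReedyCategory

attribute [instance] inv_isMultiplicative dir_isMultiplicative

/-- The opposite Reedy category: the direct and inverse parts are exchanged. -/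
instance instOpposite (A : Type u) [SmallCategory A] [ReedyCategory A] :
    ReedyCategory Aᵒᵖ where
  inv := (dir (A := A)).op
  dir := (inv (A := A)).op
  inv_isMultiplicative := inferInstance
  dir_isMultiplicative := inferInstance
  nonempty_reedyStructure := nonempty_reedyStructure.map fun r => r.op

section Prod

variable {A B : Type u} [SmallCategory A] [SmallCategory B]

theorem prod_isMultiplicative (P : MorphismProperty A) (Q : MorphismProperty B)
    [P.IsMultiplicative] [Q.IsMultiplicative] : (P.prod Q).IsMultiplicative where
  comp_mem _ _ hf hg := ⟨P.comp_mem _ _ hf.1 hg.1, Q.comp_mem _ _ hf.2 hg.2⟩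

theorem identities_prod {X Y : A × B} (f : X ⟶ Y)
    (h₁ : MorphismProperty.identities A f.1) (h₂ : MorphismProperty.identities B f.2) :
    MorphismProperty.identities (A × B) f := by
  obtain ⟨X₁, X₂⟩ := X
  obtain ⟨Y₁, Y₂⟩ := Y
  obtain ⟨f₁, f₂⟩ := f
  cases h₁
  cases h₂
  exact ⟨(X₁, X₂)⟩

variable [ReedyCategory A] [ReedyCategory B]

theorem wellFounded_prod (r : ReedyStructure (inv (A := A)) dir Ordinal.{u})
    (s : ReedyStructure (inv (A := B)) dir Ordinal.{u}) :
    WellFounded (InvImage (· < ·) fun x : A × B => (r.deg x.1, s.deg x.2)) :=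
  InvImage.wf _ wellFounded_lt

theorem prod_unique (r : ReedyStructure (inv (A := A)) dir Ordinal.{u})
    (s : ReedyStructure (inv (A := B)) dir Ordinal.{u}) {X Y : A × B} (f : X ⟶ Y) :
    Nonempty (Unique (((inv (A := A)).prod (inv (A := B))).MapFactorizationData
      ((dir (A := A)).prod (dir (A := B))) f)) := by
  let a := r.mapFactorizationData f.1
  let b := s.mapFactorizationData f.2
  refine ⟨⟨⟨⟨(a.Z, b.Z), (a.i, b.i), (a.p, b.p), ?_, ⟨a.hi, b.hi⟩, ⟨a.hp, b.hp⟩⟩⟩, ?_⟩⟩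
  · exact Prod.ext a.fac b.fac
  · rintro ⟨⟨Z₁, Z₂⟩, ⟨i₁, i₂⟩, ⟨p₁, p₂⟩, h, ⟨hi₁, hi₂⟩, ⟨hp₁, hp₂⟩⟩
    have ha := @Subsingleton.elim _ (r.subsingleton_mapFactorizationData f.1)
      ⟨Z₁, i₁, p₁, congrArg Prod.fst h, hi₁, hp₁⟩ a
    have hb := @Subsingleton.elim _ (s.subsingleton_mapFactorizationData f.2)
      ⟨Z₂, i₂, p₂, congrArg Prod.snd h, hi₂, hp₂⟩ b
    clear_value a b
    subst ha hb
    rfl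

/-- The product of two Reedy categories, with componentwise direct and inverse parts. -/
instance instProd : ReedyCategory (A × B) where
  inv := (inv (A := A)).prod (inv (A := B))
  dir := (dir (A := A)).prod (dir (A := B))
  inv_isMultiplicative := prod_isMultiplicative _ _
  dir_isMultiplicative := prod_isMultiplicative _ _
  nonempty_reedyStructure := by
    have := prod_isMultiplicative (inv (A := A)) (inv (A := B))
    have := prod_isMultiplicative (dir (A := A)) (dir (A := B))
    obtain ⟨r⟩ := nonempty_reedyStructure (A := A)
    obtain ⟨s⟩ := nonempty_reedyStructure (A := B)
    have : IsWellFounded (A × B) (InvImage (· < ·) fun x => (r.deg x.1, s.deg x.2)) :=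
      ⟨wellFounded_prod r s⟩
    refine ⟨⟨IsWellFounded.rank (InvImage (· < ·) fun x : A × B => (r.deg x.1, s.deg x.2)),
      ?_, ?_, prod_unique r s⟩⟩
    · intro X Y f hf hf'
      apply IsWellFounded.rank_lt_of_rel
      have h₁ := r.le₁ f.1 hf.1
      have h₂ := s.le₁ f.2 hf.2
      refine lt_of_le_of_ne ⟨h₁, h₂⟩ fun h => hf' (identities_prod f ?_ ?_)
      · exact r.identities_of_prop₁_of_eq hf.1 (congrArg Prod.fst h).symm
      · exact s.identities_of_prop₁_of_eq hf.2 (congrArg Prod.snd h).symm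
    · intro X Y f hf hf'
      apply IsWellFounded.rank_lt_of_rel
      have h₁ := r.le₂ f.1 hf.1
      have h₂ := s.le₂ f.2 hf.2
      refine lt_of_le_of_ne ⟨h₁, h₂⟩ fun h => hf' (identities_prod f ?_ ?_)
      · exact r.identities_of_prop₂_of_eq hf.1 (congrArg Prod.fst h)
      · exact s.identities_of_prop₂_of_eq hf.2 (congrArg Prod.snd h)

end Prod

/-! ### Latching objects and the Reedy model structure -/

section Latching

variable {J : Type u} [SmallCategory J] [ReedyCategory J]

/-- The latching category at `α`: its objects are the nonidentity morphisms `β ⟶ α` of the direct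
subcategory, and its morphisms are the commutative triangles over `α` in the direct subcategory
(a full subcategory of the slice of the direct subcategory over `α`). -/
structure LatchingCategory (α : J) : Type u where
  /-- The source `β`. -/
  obj : J
  /-- The morphism `β ⟶ α`. -/
  hom : obj ⟶ α
  dir_hom : dir hom
  not_identity : ¬ MorphismProperty.identities J hom

namespace LatchingCategory

variable {α : J}

/-- Morphisms of the latching category. -/
@[ext]
structure Hom (β γ : LatchingCategory α) : Type u where
  /-- The underlying morphism. -/
  left : β.obj ⟶ γ.obj
  dir_left : dir left
  w : left ≫ γ.hom = β.hom

instance : SmallCategory (LatchingCategory α) where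
  Hom := Hom
  id β := ⟨𝟙 β.obj, dir.id_mem _, Category.id_comp _⟩
  comp f g := ⟨f.left ≫ g.left, dir.comp_mem _ _ f.dir_left g.dir_left, by
    rw [Category.assoc, g.w, f.w]⟩
  id_comp _ := Hom.ext (Category.id_comp _)
  comp_id _ := Hom.ext (Category.comp_id _)
  assoc _ _ _ := Hom.ext (Category.assoc _ _ _)

end LatchingCategory

/-- The forgetful functor `(β ⟶ α) ↦ β` from the latching category at `α`. -/
abbrev latchingForget (α : J) : LatchingCategory α ⥤ J where
  obj β := β.obj
  map f := f.left

variable {M : Type w} [Category.{u} M] [HasColimits M]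

/-- The latching object `L_α X`, the colimit of `X β` over the latching category. -/
noncomputable abbrev latchingObj (X : J ⥤ M) (α : J) : M :=
  colimit (latchingForget α ⋙ X)

/-- The cocone of the `X β` over `X α` given by the maps `β ⟶ α` of the latching category. -/
abbrev latchingCocone (X : J ⥤ M) (α : J) : Cocone (latchingForget α ⋙ X) where
  pt := X.obj α
  ι :=
    { app := fun β => X.map β.hom
      naturality := fun β γ f => by
        change X.map f.left ≫ X.map γ.hom = X.map β.hom ≫ 𝟙 (X.obj α)
        rw [Category.comp_id, ← X.map_comp, f.w] }

/-- The canonical map `L_α X ⟶ X α`. -/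
noncomputable def latchingMap (X : J ⥤ M) (α : J) : latchingObj X α ⟶ X.obj α :=
  colimit.desc (latchingForget α ⋙ X) (latchingCocone X α)

@[simp]
theorem ι_latchingMap (X : J ⥤ M) (α : J) (β : LatchingCategory α) :
    colimit.ι (latchingForget α ⋙ X) β ≫ latchingMap X α = X.map β.hom :=
  colimit.ι_desc _ _

/-- Functoriality of the latching object. -/
noncomputable def latchingObjMap {X Y : J ⥤ M} (φ : X ⟶ Y) (α : J) :
    latchingObj X α ⟶ latchingObj Y α :=
  colimMap (Functor.whiskerLeft (latchingForget α) φ)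

theorem latchingMap_naturality {X Y : J ⥤ M} (φ : X ⟶ Y) (α : J) :
    latchingMap X α ≫ φ.app α = latchingObjMap φ α ≫ latchingMap Y α := by
  apply colimit.hom_ext
  intro β
  have h₁ : colimit.ι (latchingForget α ⋙ X) β ≫ latchingObjMap φ α =
      φ.app β.obj ≫ colimit.ι (latchingForget α ⋙ Y) β := ι_colimMap _ _
  rw [← Category.assoc, ι_latchingMap, φ.naturality, ← Category.assoc, h₁, Category.assoc,
    ι_latchingMap]

/-- The relative latching map `X α ⨿_{L_α X} L_α Y ⟶ Y α` of `φ : X ⟶ Y`. -/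
noncomputable def relativeLatchingMap {X Y : J ⥤ M} (φ : X ⟶ Y) (α : J) :
    pushout (latchingMap X α) (latchingObjMap φ α) ⟶ Y.obj α :=
  pushout.desc (φ.app α) (latchingMap Y α) (latchingMap_naturality φ α)

end Latching

section ModelStructure

variable (J : Type u) [SmallCategory J] [ReedyCategory J]
  (M : Type w) [Category.{u} M] [ModelCategory M]

/-- Weak equivalences of the Reedy model structure: the objectwise weak equivalences. -/
instance instCategoryWithWeakEquivalences : CategoryWithWeakEquivalences (J ⥤ M) where
  weakEquivalences := fun _ _ φ => ∀ α, weakEquivalences M (φ.app α)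

/-- Cofibrations of the Reedy model structure: the maps all of whose relative latching maps are
cofibrations. -/
instance instCategoryWithCofibrations [HasColimits M] : CategoryWithCofibrations (J ⥤ M) where
  cofibrations := fun _ _ φ => ∀ α, cofibrations M (relativeLatchingMap φ α)

end ModelStructure

end ReedyCategory

/-! ### Quillen adjunctions in one and in two variables -/

section Quillen

universe v₁ v₂ v₃ u₁ u₂ u₃

/-- An adjunction is a Quillen adjunction if its left adjoint preserves cofibrations and trivial
cofibrations. -/
structure IsQuillenAdjunction {C : Type u₁} [Category.{v₁} C] {D : Type u₂} [Category.{v₂} D]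
    [CategoryWithCofibrations C] [CategoryWithWeakEquivalences C]
    [CategoryWithCofibrations D] [CategoryWithWeakEquivalences D]
    {F : C ⥤ D} {G : D ⥤ C} (_adj : F ⊣ G) : Prop where
  map_cofibrations : ∀ ⦃X Y : C⦄ (i : X ⟶ Y), cofibrations C i → cofibrations D (F.map i)
  map_trivialCofibrations : ∀ ⦃X Y : C⦄ (i : X ⟶ Y),
    trivialCofibrations C i → trivialCofibrations D (F.map i)

variable {C₁ : Type u₁} [Category.{v₁} C₁] {C₂ : Type u₂} [Category.{v₂} C₂]
  {C₃ : Type u₃} [Category.{v₃} C₃]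

/-- An adjunction of two variables: isomorphisms
`Hom(F(X, Y), Z) ≅ Hom(Y, G(X, Z)) ≅ Hom(X, H(Y, Z))`, natural in all the variables. -/
structure AdjunctionOfTwoVariables (F : C₁ ⥤ C₂ ⥤ C₃) (G : C₁ᵒᵖ ⥤ C₃ ⥤ C₂)
    (H : C₂ᵒᵖ ⥤ C₃ ⥤ C₁) where
  /-- The adjunction in the second variable, with parameter in the first. -/
  adjLeft : F ⊣₂ G
  /-- The adjunction in the first variable, with parameter in the second. -/
  adjRight : F.flip ⊣₂ H

variable [CategoryWithCofibrations C₁] [CategoryWithWeakEquivalences C₁]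
  [CategoryWithCofibrations C₂] [CategoryWithWeakEquivalences C₂]
  [CategoryWithCofibrations C₃] [CategoryWithWeakEquivalences C₃]

/-- The pushout-product axiom: the pushout-product
`F(Y₁, X₂) ⨿_{F(X₁, X₂)} F(X₁, Y₂) ⟶ F(Y₁, Y₂)` of two cofibrations is a cofibration, and it is
trivial if one of them is. -/
structure PushoutProductAxiom (F : C₁ ⥤ C₂ ⥤ C₃) : Prop where
  cofibration : ∀ ⦃X₁ Y₁ : C₁⦄ (i : X₁ ⟶ Y₁) ⦃X₂ Y₂ : C₂⦄ (j : X₂ ⟶ Y₂)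
    (sq : F.PushoutObjObj i j),
    cofibrations C₁ i → cofibrations C₂ j → cofibrations C₃ sq.ι
  trivial_left : ∀ ⦃X₁ Y₁ : C₁⦄ (i : X₁ ⟶ Y₁) ⦃X₂ Y₂ : C₂⦄ (j : X₂ ⟶ Y₂)
    (sq : F.PushoutObjObj i j),
    trivialCofibrations C₁ i → cofibrations C₂ j → trivialCofibrations C₃ sq.ι
  trivial_right : ∀ ⦃X₁ Y₁ : C₁⦄ (i : X₁ ⟶ Y₁) ⦃X₂ Y₂ : C₂⦄ (j : X₂ ⟶ Y₂)
    (sq : F.PushoutObjObj i j),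
    cofibrations C₁ i → trivialCofibrations C₂ j → trivialCofibrations C₃ sq.ι

/-- A Quillen adjunction of two variables is an adjunction of two variables whose left adjoint
satisfies the pushout-product axiom. -/
def AdjunctionOfTwoVariables.IsQuillen {F : C₁ ⥤ C₂ ⥤ C₃} {G : C₁ᵒᵖ ⥤ C₃ ⥤ C₂}
    {H : C₂ᵒᵖ ⥤ C₃ ⥤ C₁} (_adj : AdjunctionOfTwoVariables F G H) : Prop :=
  PushoutProductAxiom F

end Quillen

/-- A symmetric monoidal model category: a closed symmetric monoidal category with a model
structure that satisfies the pushout-product axiom and the unit axiom. -/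
class SymmetricMonoidalModelCategory (M : Type w) [Category.{u} M] [ModelCategory M]
    [MonoidalCategory M] [SymmetricCategory M] [MonoidalClosed M] : Prop where
  pushoutProduct : PushoutProductAxiom (curriedTensor M)
  unit : ∃ (Q : M) (q : Q ⟶ 𝟙_ M), IsCofibrant Q ∧ weakEquivalences M q ∧
    ∀ X : M, IsCofibrant X → weakEquivalences M (q ▷ X)

/-! ### Right fibrations of Reedy categories -/

/-- A morphism of Reedy categories: a functor that preserves the direct and inverse parts. -/
structure IsReedyMorphism {A B : Type u} [SmallCategory A] [SmallCategory B]
    [ReedyCategory A] [ReedyCategory B] (f : A ⥤ B) : Prop where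
  map_inv : ∀ ⦃X Y : A⦄ (φ : X ⟶ Y), ReedyCategory.inv φ → ReedyCategory.inv (f.map φ)
  map_dir : ∀ ⦃X Y : A⦄ (φ : X ⟶ Y), ReedyCategory.dir φ → ReedyCategory.dir (f.map φ)

/-- A right fibration of Reedy categories: a morphism `f : A ⥤ B` such that, for every complete
and cocomplete model category `M`, the adjunction `f^* ⊣ f_*` between restriction
`(B ⥤ M) ⥤ (A ⥤ M)` and right Kan extension is a Quillen adjunction for the Reedy model
structures. -/
structure IsRightFibration {A B : Type u} [SmallCategory A] [SmallCategory B]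
    [ReedyCategory A] [ReedyCategory B] (f : A ⥤ B) : Prop extends IsReedyMorphism f where
  isQuillenAdjunction : ∀ (M : Type w) [Category.{u} M] [ModelCategory M] [HasLimits M]
    [HasColimits M], IsQuillenAdjunction (f.ranAdjunction M)

/-! ### Day convolution -/

section Day

variable (A : Type u) [SmallCategory A]
  (M : Type w) [Category.{u} M] [MonoidalCategory M]

/-- The exterior tensor product of presheaves, `(X ⊠ Y)(α, α') = X α ⊗ Y α'`, as a presheaf on
`A × A`. -/
abbrev exteriorProduct : (Aᵒᵖ ⥤ M) ⥤ (Aᵒᵖ ⥤ M) ⥤ ((A × A)ᵒᵖ ⥤ M) :=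
  (Functor.postcompose₂.obj
    (Functor.uncurry ⋙ (Functor.whiskeringLeft _ _ M).obj (prodOpEquiv A).functor)).obj
    (externalProductBifunctorCurried Aᵒᵖ Aᵒᵖ M)

/-- The Day convolution `∘_!(X ⊠ Y)`, the left Kan extension of the exterior tensor product along
the opposite of the tensor product `∘ : A × A ⥤ A`. -/
noncomputable abbrev dayConvolution [MonoidalCategory A] [HasColimits M] :
    (Aᵒᵖ ⥤ M) ⥤ (Aᵒᵖ ⥤ M) ⥤ (Aᵒᵖ ⥤ M) :=
  (Functor.postcompose₂.obj ((tensor A).op.lan)).obj (exteriorProduct A M)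

end Day

/-! Reedy cofibrations (trivial cofibrations) are the maps whose relative latching maps lift against
all trivial fibrations (fibrations) `p` of `M`. `LatchingLift` states this with compatible families
instead of colimits, and only lifting properties are used: no Reedy model structure is constructed.
For trivial cofibrations this rests on `trivialCofibrations_iff`.

Lifting the relative latching map at `γ` against `p` follows from lifting the whole map of diagrams
against the single map `coinducedMap (boundary γ) p`, the pullback-cotensor of `p` with the
inclusion of the boundary of `γ` into the functor represented by `γ`
(`latchingLift_of_hasLiftingProperty`). The relative matching maps of `coinducedMap (boundary γ) p`
have the right lifting property against every map against which `p` has it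
(`matchingLift_coinducedMap`), so it is a Reedy fibration, trivial if `p` is.

Left Kan extension along the monoidal product preserves pushouts, so the Day pushout-product is the
Kan extension of the exterior one. By adjunction it suffices to lift the exterior pushout-product
against the restriction of `coinducedMap (boundary γ) p`. The right fibration hypothesis, applied to
the model category `Mᵒᵖ`, says that restriction of `M`-valued presheaves preserves Reedy fibrations
and trivial fibrations, since dualizing turns matching maps into latching maps. The exterior
pushout-product is a Reedy cofibration, trivial when it should be, because its relative latching map
at a pair is the pushout-product of the two relative latching maps (`latchingLift_exteriorProduct`).
The Reedy induction on the degree (`hasLiftingProperty_of_latching_matching`) then produces the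
lift.

The adjoints exist because the exterior product with a fixed presheaf is restriction along a
projection followed by an objectwise tensor product, and both are left adjoints. -/

/-- Dependent choice along a transitive well-founded relation. -/
theorem exists_forall_of_wellFounded {ι : Type*} {r : ι → ι → Prop} (wf : WellFounded r)
    (tr : ∀ {a b c}, r a b → r b c → r a c) {T : ι → Type*}
    (P : ∀ a, (∀ b, r b a → T b) → T a → Prop)
    (step : ∀ a (l : ∀ b, r b a → T b),
      (∀ b (hb : r b a), P b (fun c hc => l c (tr hc hb)) (l b hb)) → ∃ t, P a l t) :
    ∃ l : ∀ a, T a, ∀ a, P a (fun b _ => l b) (l a) := by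
  classical
  -- The recursion is `Option`-valued: `P` need not be carried along in the type, and `none` records
  -- a failure, which `key` excludes.
  let F : ∀ a, (∀ b, r b a → Option (T b)) → Option (T a) := fun a rec =>
    if h : ∃ (hs : ∀ b hb, (rec b hb).isSome) (t : T a), P a (fun b hb => (rec b hb).get (hs b hb)) t
    then some h.choose_spec.choose else none
  let G : ∀ a, Option (T a) := wf.fix F
  have hG : ∀ a, G a = F a (fun b _ => G b) := fun a => wf.fix_eq F a
  have key : ∀ a, ∃ hs : (∀ b, r b a → (G b).isSome), ∃ ha : (G a).isSome,
      P a (fun b hb => (G b).get (hs b hb)) ((G a).get ha) := by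
    intro a
    induction a using wf.induction with
    | _ a ih =>
      have hs : ∀ b, r b a → (G b).isSome := fun b hb => (ih b hb).choose_spec.choose
      have h : ∃ (hs : ∀ b, r b a → (G b).isSome) (t : T a),
          P a (fun b hb => (G b).get (hs b hb)) t :=
        ⟨hs, step a _ fun b hb => (ih b hb).choose_spec.choose_spec⟩
      have e : G a = some h.choose_spec.choose := by
        rw [hG]
        exact dif_pos h
      refine ⟨hs, by rw [e]; rfl, ?_⟩
      have := h.choose_spec.choose_spec
      convert this
      simp [e]
  exact ⟨fun a => (G a).get (key a).choose_spec.choose, fun a => (key a).choose_spec.choose_spec⟩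

/-! ### Degrees and Reedy factorizations -/

namespace ReedyCategory

section

variable {J : Type u} [SmallCategory J] [ReedyCategory J]

variable (J) in
/-- A choice of degree function. -/
noncomputable def reedyStructure : ReedyStructure (inv (A := J)) dir Ordinal.{u} :=
  nonempty_reedyStructure.some

/-- The degree of an object. -/
noncomputable def deg (α : J) : Ordinal.{u} := (reedyStructure J).deg α

theorem identities_iff {C : Type*} [Category* C] {X Y : C} (f : X ⟶ Y) :
    MorphismProperty.identities C f ↔ ∃ h : X = Y, f = eqToHom h := by
  constructor
  · rintro ⟨⟩
    exact ⟨rfl, rfl⟩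
  · rintro ⟨rfl, rfl⟩
    exact ⟨_⟩

variable {α β γ : J}

theorem deg_lt_of_dir {h : β ⟶ α} (hd : dir h) (hn : ¬ MorphismProperty.identities J h) :
    deg β < deg α := (reedyStructure J).lt₂ h hd hn

theorem deg_lt_of_inv {h : β ⟶ α} (hd : inv h) (hn : ¬ MorphismProperty.identities J h) :
    deg α < deg β := (reedyStructure J).lt₁ h hd hn

theorem deg_le_of_dir {h : β ⟶ α} (hd : dir h) : deg β ≤ deg α := (reedyStructure J).le₂ h hd

theorem deg_le_of_inv {h : β ⟶ α} (hd : inv h) : deg α ≤ deg β := (reedyStructure J).le₁ h hd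

theorem not_identities_comp_of_dir {k : γ ⟶ β} {h : β ⟶ α} (hk : dir k) (hh : dir h)
    (hn : ¬ MorphismProperty.identities J h) : ¬ MorphismProperty.identities J (k ≫ h) := by
  intro hi
  have h₁ := deg_le_of_dir hk
  have h₂ := deg_lt_of_dir hh hn
  obtain ⟨rfl, -⟩ := (identities_iff _).1 hi
  exact (h₁.trans_lt h₂).false

theorem not_identities_comp_of_inv {k : α ⟶ β} {h : β ⟶ γ} (hk : inv k) (hh : inv h)
    (hn : ¬ MorphismProperty.identities J k) : ¬ MorphismProperty.identities J (k ≫ h) := by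
  intro hi
  have h₁ := deg_le_of_inv hh
  have h₂ := deg_lt_of_inv hk hn
  obtain ⟨rfl, -⟩ := (identities_iff _).1 hi
  exact (h₁.trans_lt h₂).false

theorem exists_fac (k : β ⟶ γ) : ∃ (δ : J) (i : β ⟶ δ) (d : δ ⟶ γ), inv i ∧ dir d ∧ i ≫ d = k := by
  obtain ⟨Z, a, b, ha, hb, h, -⟩ := (reedyStructure J).exists_fac k
  exact ⟨Z, a, b, ha, hb, h⟩

/-- Two Reedy factorizations of a map coincide. -/
theorem fac_unique {δ δ' : J} {i : β ⟶ δ} {d : δ ⟶ γ} {i' : β ⟶ δ'} {d' : δ' ⟶ γ}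
    (hi : inv i) (hd : dir d) (hi' : inv i') (hd' : dir d') (h : i ≫ d = i' ≫ d') :
    ∃ e : δ = δ', i' = i ≫ eqToHom e ∧ d = eqToHom e ≫ d' := by
  let F : (inv (A := J)).MapFactorizationData dir (i ≫ d) := ⟨δ, i, d, rfl, hi, hd⟩
  let F' : (inv (A := J)).MapFactorizationData dir (i ≫ d) := ⟨δ', i', d', h.symm, hi', hd'⟩
  have : F = F' := @Subsingleton.elim _ ((reedyStructure J).subsingleton_mapFactorizationData _) _ _
  simp only [F, F', MorphismProperty.MapFactorizationData.mk.injEq] at this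
  obtain ⟨rfl, h₁, h₂⟩ := this
  cases h₁
  cases h₂
  exact ⟨rfl, by simp, by simp⟩

end

/-! ### Latching lifts, Reedy cofibrations and Reedy trivial cofibrations -/

section Latching

variable {J : Type u} [SmallCategory J] [ReedyCategory J]
  {M : Type w} [Category.{u} M]

/-- The lifting property of the relative latching map of `φ` at `α` against `p`, without
reference to colimits. -/
def LatchingLift {X Y : J ⥤ M} (φ : X ⟶ Y) (α : J) {E B : M} (p : E ⟶ B) : Prop :=
  ∀ (x : X.obj α ⟶ E) (v : ∀ β : LatchingCategory α, Y.obj β.obj ⟶ E) (b : Y.obj α ⟶ B),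
    (∀ ⦃β γ : LatchingCategory α⦄ (f : β ⟶ γ), Y.map f.left ≫ v γ = v β) →
    (∀ β, X.map β.hom ≫ x = φ.app β.obj ≫ v β) →
    x ≫ p = φ.app α ≫ b → (∀ β, v β ≫ p = Y.map β.hom ≫ b) →
    ∃ l : Y.obj α ⟶ E, φ.app α ≫ l = x ∧ (∀ β, Y.map β.hom ≫ l = v β) ∧ l ≫ p = b

section

variable [HasColimits M] {X Y : J ⥤ M} (φ : X ⟶ Y) (α : J)

@[simp]
theorem ι_latchingObjMap (β : LatchingCategory α) :
    colimit.ι (latchingForget α ⋙ X) β ≫ latchingObjMap φ α =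
      φ.app β.obj ≫ colimit.ι (latchingForget α ⋙ Y) β := ι_colimMap _ _

theorem ι_latchingObjMap_assoc (β : LatchingCategory α) {E : M} (f : latchingObj Y α ⟶ E) :
    colimit.ι (latchingForget α ⋙ X) β ≫ latchingObjMap φ α ≫ f =
      φ.app β.obj ≫ colimit.ι (latchingForget α ⋙ Y) β ≫ f := by
  rw [← Category.assoc, ι_latchingObjMap, Category.assoc]

@[simp]
theorem inl_relativeLatchingMap :
    pushout.inl (latchingMap X α) (latchingObjMap φ α) ≫ relativeLatchingMap φ α = φ.app α :=
  pushout.inl_desc _ _ _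

theorem inl_relativeLatchingMap_assoc {E : M} (f : Y.obj α ⟶ E) :
    pushout.inl (latchingMap X α) (latchingObjMap φ α) ≫ relativeLatchingMap φ α ≫ f =
      φ.app α ≫ f := by
  rw [← Category.assoc, inl_relativeLatchingMap]

@[simp]
theorem inr_relativeLatchingMap :
    pushout.inr (latchingMap X α) (latchingObjMap φ α) ≫ relativeLatchingMap φ α =
      latchingMap Y α :=
  pushout.inr_desc _ _ _

theorem inr_relativeLatchingMap_assoc {E : M} (f : Y.obj α ⟶ E) :
    pushout.inr (latchingMap X α) (latchingObjMap φ α) ≫ relativeLatchingMap φ α ≫ f =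
      latchingMap Y α ≫ f := by
  rw [← Category.assoc, inr_relativeLatchingMap]

/-- Maps out of the source of the relative latching map. -/
theorem exists_relativeLatching_desc {E : M} (x : X.obj α ⟶ E)
    (v : ∀ β : LatchingCategory α, Y.obj β.obj ⟶ E)
    (hv : ∀ ⦃β γ : LatchingCategory α⦄ (f : β ⟶ γ), Y.map f.left ≫ v γ = v β)
    (hx : ∀ β, X.map β.hom ≫ x = φ.app β.obj ≫ v β) :
    ∃ d : pushout (latchingMap X α) (latchingObjMap φ α) ⟶ E,
      pushout.inl _ _ ≫ d = x ∧
        ∀ β, colimit.ι (latchingForget α ⋙ Y) β ≫ pushout.inr _ _ ≫ d = v β := by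
  let c : Cocone (latchingForget α ⋙ Y) :=
    { pt := E
      ι := { app := v
             naturality := fun β γ f => (hv f).trans (Category.comp_id _).symm } }
  have hc : ∀ β, colimit.ι (latchingForget α ⋙ Y) β ≫ colimit.desc _ c = v β := fun β =>
    colimit.ι_desc c β
  refine ⟨pushout.desc x (colimit.desc _ c) ?_, pushout.inl_desc _ _ _, fun β => ?_⟩
  · apply colimit.hom_ext
    intro β
    rw [← Category.assoc, ι_latchingMap, hx, ι_latchingObjMap_assoc, hc]
  · rw [pushout.inr_desc, hc]

variable {α} in
theorem relativeLatching_hom_ext {E : M}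
    {f g : pushout (latchingMap X α) (latchingObjMap φ α) ⟶ E}
    (h : pushout.inl _ _ ≫ f = pushout.inl _ _ ≫ g)
    (h' : ∀ β, colimit.ι (latchingForget α ⋙ Y) β ≫ pushout.inr _ _ ≫ f =
      colimit.ι (latchingForget α ⋙ Y) β ≫ pushout.inr _ _ ≫ g) : f = g :=
  pushout.hom_ext h (colimit.hom_ext h')

/-- A map out of the source of the relative latching map is a pair of a map `x` on `X α` and a
compatible family `v`, so both sides describe the same lifting problems. -/
theorem hasLiftingProperty_relativeLatchingMap_iff {E B : M} (p : E ⟶ B) :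
    HasLiftingProperty (relativeLatchingMap φ α) p ↔ LatchingLift φ α p := by
  constructor
  · intro H x v b hv hx hb hvb
    obtain ⟨d, hd₁, hd₂⟩ := exists_relativeLatching_desc φ α x v hv hx
    have sq : CommSq d (relativeLatchingMap φ α) p b := ⟨by
      apply relativeLatching_hom_ext
      · rw [reassoc_of% hd₁, inl_relativeLatchingMap_assoc, hb]
      · intro β
        rw [reassoc_of% hd₂, hvb, inr_relativeLatchingMap_assoc, ← Category.assoc, ι_latchingMap]⟩
    refine ⟨sq.lift, ?_, fun β => ?_, sq.fac_right⟩
    · rw [← hd₁, ← inl_relativeLatchingMap, Category.assoc, sq.fac_left]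
    · rw [← hd₂, ← ι_latchingMap, ← inr_relativeLatchingMap φ, Category.assoc, Category.assoc,
        sq.fac_left]
  · intro H
    refine ⟨fun {f b} sq => ?_⟩
    obtain ⟨l, h₁, h₂, h₃⟩ := H (pushout.inl _ _ ≫ f)
      (fun β => colimit.ι (latchingForget α ⋙ Y) β ≫ pushout.inr _ _ ≫ f) b
      (fun β γ k => by
        rw [← Category.assoc]
        exact congrArg (· ≫ _) (colimit.w (latchingForget α ⋙ Y) k))
      (fun β => by
        rw [← ι_latchingMap, Category.assoc, pushout.condition_assoc, ι_latchingObjMap_assoc])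
      (by rw [Category.assoc, sq.w, inl_relativeLatchingMap_assoc])
      (fun β => by
        rw [Category.assoc, Category.assoc, sq.w, inr_relativeLatchingMap_assoc, ← Category.assoc,
          ι_latchingMap])
    refine ⟨⟨⟨l, relativeLatching_hom_ext φ ?_ fun β => ?_, h₃⟩⟩⟩
    · rw [inl_relativeLatchingMap_assoc, h₁]
    · rw [inr_relativeLatchingMap_assoc, ← Category.assoc, ι_latchingMap, h₂]

end

/-- Lifting a family of squares indexed by a sieve `Q` of direct maps to `α`. -/
theorem exists_lift_family {X Y : J ⥤ M} (φ : X ⟶ Y) {α : J} {E B : M} (p : E ⟶ B)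
    (Q : ∀ ⦃β : J⦄, (β ⟶ α) → Prop)
    (hQ : ∀ ⦃β γ : J⦄ (k : β ⟶ γ) (h : γ ⟶ α), dir k → Q h → Q (k ≫ h))
    (H : ∀ ⦃β : J⦄ (h : β ⟶ α), Q h → LatchingLift φ β p)
    (x : ∀ ⦃β : J⦄ (h : β ⟶ α), Q h → (X.obj β ⟶ E))
    (y : ∀ ⦃β : J⦄ (h : β ⟶ α), Q h → (Y.obj β ⟶ B))
    (hx : ∀ ⦃β γ : J⦄ (k : β ⟶ γ) (h : γ ⟶ α) (hk : dir k) (hh : Q h),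
      X.map k ≫ x h hh = x (k ≫ h) (hQ k h hk hh))
    (hy : ∀ ⦃β γ : J⦄ (k : β ⟶ γ) (h : γ ⟶ α) (hk : dir k) (hh : Q h),
      Y.map k ≫ y h hh = y (k ≫ h) (hQ k h hk hh))
    (sq : ∀ ⦃β : J⦄ (h : β ⟶ α) (hh : Q h), x h hh ≫ p = φ.app β ≫ y h hh) :
    ∃ v : ∀ ⦃β : J⦄ (h : β ⟶ α), Q h → (Y.obj β ⟶ E),
      (∀ ⦃β : J⦄ (h : β ⟶ α) (hh : Q h), φ.app β ≫ v h hh = x h hh ∧ v h hh ≫ p = y h hh) ∧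
      ∀ ⦃β γ : J⦄ (k : β ⟶ γ) (h : γ ⟶ α) (hk : dir k) (hh : Q h),
        Y.map k ≫ v h hh = v (k ≫ h) (hQ k h hk hh) := by
  -- Induction on the degree of the source, for all maps of `Q` with that source at once.
  -- Compatibility is imposed only along nonidentity direct maps, where the degree drops; identities
  -- are treated at the end.
  obtain ⟨v, hv⟩ := exists_forall_of_wellFounded
    (r := fun β γ : J => deg β < deg γ) (InvImage.wf _ wellFounded_lt) (fun h h' => h.trans h')
    (T := fun β => ∀ h : β ⟶ α, Q h → (Y.obj β ⟶ E))
    (P := fun γ l t => ∀ (h : γ ⟶ α) (hh : Q h),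
      (φ.app γ ≫ t h hh = x h hh ∧ t h hh ≫ p = y h hh) ∧
      ∀ ⦃β : J⦄ (k : β ⟶ γ) (hk : dir k) (hn : ¬ MorphismProperty.identities J k),
        Y.map k ≫ t h hh = l β (deg_lt_of_dir hk hn) (k ≫ h) (hQ k h hk hh)) (by
    intro γ l hl
    have : ∀ (h : γ ⟶ α) (hh : Q h), ∃ t : Y.obj γ ⟶ E,
      (φ.app γ ≫ t = x h hh ∧ t ≫ p = y h hh) ∧
      ∀ ⦃β : J⦄ (k : β ⟶ γ) (hk : dir k) (hn : ¬ MorphismProperty.identities J k),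
        Y.map k ≫ t = l β (deg_lt_of_dir hk hn) (k ≫ h) (hQ k h hk hh) := by
      intro h hh
      obtain ⟨t, h₁, h₂, h₃⟩ := H h hh (x h hh)
        (fun β => l β.obj (deg_lt_of_dir β.dir_hom β.not_identity) (β.hom ≫ h)
          (hQ _ _ β.dir_hom hh)) (y h hh)
        (fun β δ f => by
          -- A morphism of the latching category may lie over an identity, where the induction
          -- hypothesis says nothing but the compatibility is trivial.
          by_cases hf : MorphismProperty.identities J f.left
          · obtain ⟨β, b, hb, hb'⟩ := β
            obtain ⟨δ, d, hd, hd'⟩ := δ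
            obtain ⟨f, hf', hf''⟩ := f
            dsimp at hf f hf'' ⊢
            obtain ⟨rfl, rfl⟩ := (identities_iff _).1 hf
            simp only [eqToHom_refl, Category.id_comp] at hf''
            subst hf''
            simp
          · rw [((hl δ.obj (deg_lt_of_dir δ.dir_hom δ.not_identity) _ _).2 f.left f.dir_left hf)]
            simp only [← f.w, Category.assoc])
        (fun β => by
          rw [((hl β.obj (deg_lt_of_dir β.dir_hom β.not_identity) _ _).1.1), hx _ _ β.dir_hom])
        (sq h hh)
        (fun β => by
          rw [((hl β.obj (deg_lt_of_dir β.dir_hom β.not_identity) _ _).1.2), hy _ _ β.dir_hom])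
      exact ⟨t, ⟨h₁, h₃⟩, fun β k hk hn => h₂ ⟨β, k, hk, hn⟩⟩
    choose t ht using this
    exact ⟨t, ht⟩)
  refine ⟨fun β h hh => v β h hh, fun β h hh => (hv β h hh).1, fun β γ k h hk hh => ?_⟩
  by_cases hn : MorphismProperty.identities J k
  · obtain ⟨rfl, rfl⟩ := (identities_iff _).1 hn
    simp
  · exact (hv γ h hh).2 k hk hn

/-- The square at `α` is pulled back along all direct maps to `α`; the resulting family of lifts,
evaluated at `𝟙 α`, solves it. -/
theorem hasLiftingProperty_app {X Y : J ⥤ M} (φ : X ⟶ Y) (α : J) {E B : M} (p : E ⟶ B)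
    (H : ∀ β, LatchingLift φ β p) : HasLiftingProperty (φ.app α) p := by
  refine ⟨fun {f b} sq => ?_⟩
  obtain ⟨v, hv, -⟩ := exists_lift_family φ p (fun β h => dir h)
    (fun _ _ _ _ => dir.comp_mem _ _) (fun β _ _ => H β) (fun β h _ => X.map h ≫ f)
    (fun β h _ => Y.map h ≫ b) (by simp) (by simp) (by simp [sq.w])
  have := hv (𝟙 α) (dir.id_mem _)
  exact ⟨⟨⟨v (𝟙 α) (dir.id_mem _), by simpa using this.1, by simpa using this.2⟩⟩⟩

/-- A compatible family of lifts over the nonidentity direct maps to `α` is a lift on the colimit.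
Their sources have smaller degree, so only these degrees enter the hypothesis; this is what makes
the induction in `trivialCofibrations_iff` possible. -/
theorem hasLiftingProperty_latchingObjMap [HasColimits M] {X Y : J ⥤ M} (φ : X ⟶ Y) (α : J)
    {E B : M} (p : E ⟶ B) (H : ∀ β, deg β < deg α → LatchingLift φ β p) :
    HasLiftingProperty (latchingObjMap φ α) p := by
  refine ⟨fun {f b} sq => ?_⟩
  obtain ⟨v, hv, hv'⟩ := exists_lift_family φ p
    (fun β h => dir h ∧ ¬ MorphismProperty.identities J h)
    (fun _ _ _ _ hk hh => ⟨dir.comp_mem _ _ hk hh.1, not_identities_comp_of_dir hk hh.1 hh.2⟩)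
    (fun β h hh => H β (deg_lt_of_dir hh.1 hh.2))
    (fun β h hh => colimit.ι (latchingForget α ⋙ X) ⟨β, h, hh.1, hh.2⟩ ≫ f)
    (fun β h hh => colimit.ι (latchingForget α ⋙ Y) ⟨β, h, hh.1, hh.2⟩ ≫ b)
    (fun β γ k h hk hh => by
      rw [← Category.assoc]
      exact congrArg (· ≫ f) (colimit.w (latchingForget α ⋙ X)
        (j' := ⟨β, k ≫ h, dir.comp_mem _ _ hk hh.1, not_identities_comp_of_dir hk hh.1 hh.2⟩)
        (j := ⟨γ, h, hh.1, hh.2⟩) ⟨k, hk, rfl⟩))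
    (fun β γ k h hk hh => by
      rw [← Category.assoc]
      exact congrArg (· ≫ b) (colimit.w (latchingForget α ⋙ Y)
        (j' := ⟨β, k ≫ h, dir.comp_mem _ _ hk hh.1, not_identities_comp_of_dir hk hh.1 hh.2⟩)
        (j := ⟨γ, h, hh.1, hh.2⟩) ⟨k, hk, rfl⟩))
    (fun β h hh => by rw [Category.assoc, sq.w, ι_latchingObjMap_assoc])
  let c : Cocone (latchingForget α ⋙ Y) :=
    { pt := E
      ι := { app := fun β => v β.hom ⟨β.dir_hom, β.not_identity⟩
             naturality := fun β γ k => by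
              refine Eq.trans ?_ (Category.comp_id _).symm
              refine (hv' k.left γ.hom k.dir_left _).trans ?_
              simp only [k.w] } }
  have hc : ∀ β, colimit.ι (latchingForget α ⋙ Y) β ≫ colimit.desc _ c =
      v β.hom ⟨β.dir_hom, β.not_identity⟩ := fun β => colimit.ι_desc c β
  refine ⟨⟨⟨colimit.desc _ c, colimit.hom_ext fun β => ?_, colimit.hom_ext fun β => ?_⟩⟩⟩
  · rw [ι_latchingObjMap_assoc, hc]
    exact (hv β.hom ⟨β.dir_hom, β.not_identity⟩).1
  · rw [← Category.assoc, hc]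
    exact (hv β.hom ⟨β.dir_hom, β.not_identity⟩).2

variable [ModelCategory M] [HasColimits M] {X Y : J ⥤ M} (φ : X ⟶ Y)

theorem cofibrations_iff_latchingLift :
    cofibrations (J ⥤ M) φ ↔
      ∀ (α : J) ⦃E B : M⦄ (p : E ⟶ B), trivialFibrations M p → LatchingLift φ α p := by
  refine forall_congr' fun α => ?_
  rw [← trivialFibrations_llp]
  simp only [← hasLiftingProperty_relativeLatchingMap_iff]
  rfl

theorem forall_trivialCofibrations_relativeLatchingMap_iff :
    (∀ α, trivialCofibrations M (relativeLatchingMap φ α)) ↔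
      ∀ (α : J) ⦃E B : M⦄ (p : E ⟶ B), fibrations M p → LatchingLift φ α p := by
  refine forall_congr' fun α => ?_
  rw [← fibrations_llp]
  simp only [← hasLiftingProperty_relativeLatchingMap_iff]
  rfl

/-- Reedy trivial cofibrations are the maps whose relative latching maps are trivial
cofibrations. -/
theorem trivialCofibrations_iff :
    trivialCofibrations (J ⥤ M) φ ↔ ∀ α, trivialCofibrations M (relativeLatchingMap φ α) := by
  constructor
  · rintro ⟨hc, hw⟩ α
    induction α using (InvImage.wf (deg (J := J)) wellFounded_lt).induction with
    | _ α ih =>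
    have h₁ : trivialCofibrations M (latchingObjMap φ α) := by
      rw [← fibrations_llp]
      intro E B p hp
      refine hasLiftingProperty_latchingObjMap φ α p fun β hβ => ?_
      rw [← hasLiftingProperty_relativeLatchingMap_iff]
      have := ih β hβ
      rw [← fibrations_llp] at this
      exact this p hp
    have h₂ := MorphismProperty.of_isPushout (P := trivialCofibrations M)
      (IsPushout.of_hasPushout (latchingMap X α) (latchingObjMap φ α)) h₁
    -- The map `φ.app α` is the cobase change of `latchingObjMap φ α`, a trivial cofibration,
    -- followed by the relative latching map; two-out-of-three applies.
    refine ⟨hc α, (weakEquivalences M).of_precomp _ _ h₂.2 ?_⟩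
    rw [inl_relativeLatchingMap]
    exact hw α
  · intro h
    refine ⟨fun α => (h α).1, fun α => ?_⟩
    suffices trivialCofibrations M (φ.app α) from this.2
    rw [← fibrations_llp]
    intro E B p hp
    exact hasLiftingProperty_app φ α p fun β =>
      (forall_trivialCofibrations_relativeLatchingMap_iff φ).1 h β p hp

theorem trivialCofibrations_iff_latchingLift :
    trivialCofibrations (J ⥤ M) φ ↔
      ∀ (α : J) ⦃E B : M⦄ (p : E ⟶ B), fibrations M p → LatchingLift φ α p :=
  (trivialCofibrations_iff φ).trans (forall_trivialCofibrations_relativeLatchingMap_iff φ)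

end Latching

end ReedyCategory

namespace ReedyCategory

/-! ### Lifts of diagrams by induction on the degree -/

section Lifting

variable {J : Type u} [SmallCategory J] [ReedyCategory J] {M : Type w} [Category.{u} M]

/-- A partial family that commutes with the nonidentity direct and inverse maps is natural. -/
theorem naturality_of_dir_of_inv {Y Z : J ⥤ M} (o : Ordinal.{u})
    (l : ∀ β : J, deg β < o → (Y.obj β ⟶ Z.obj β))
    (hd : ∀ ⦃β γ : J⦄ (h : β ⟶ γ) (hβ : deg β < o) (hγ : deg γ < o), dir h →
      ¬ MorphismProperty.identities J h → Y.map h ≫ l γ hγ = l β hβ ≫ Z.map h)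
    (hi : ∀ ⦃β γ : J⦄ (h : β ⟶ γ) (hβ : deg β < o) (hγ : deg γ < o), inv h →
      ¬ MorphismProperty.identities J h → Y.map h ≫ l γ hγ = l β hβ ≫ Z.map h)
    ⦃β γ : J⦄ (h : β ⟶ γ) (hβ : deg β < o) (hγ : deg γ < o) :
    Y.map h ≫ l γ hγ = l β hβ ≫ Z.map h := by
  have hid : ∀ ⦃β γ : J⦄ (h : β ⟶ γ) (hβ : deg β < o) (hγ : deg γ < o),
      MorphismProperty.identities J h → Y.map h ≫ l γ hγ = l β hβ ≫ Z.map h := by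
    intro β γ h hβ hγ hh
    obtain ⟨rfl, rfl⟩ := (identities_iff _).1 hh
    simp
  obtain ⟨δ, i, d, hi', hd', rfl⟩ := exists_fac h
  -- The middle object of the Reedy factorization has degree at most that of `β`, so the partial
  -- family is defined there.
  have hδ : deg δ < o := (deg_le_of_inv hi').trans_lt hβ
  have h₁ : Y.map i ≫ l δ hδ = l β hβ ≫ Z.map i := by
    by_cases hn : MorphismProperty.identities J i
    exacts [hid _ _ _ hn, hi _ _ _ hi' hn]
  have h₂ : Y.map d ≫ l γ hγ = l δ hδ ≫ Z.map d := by
    by_cases hn : MorphismProperty.identities J d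
    exacts [hid _ _ _ hn, hd _ _ _ hd' hn]
  rw [Functor.map_comp, Functor.map_comp, Category.assoc, h₂, reassoc_of% h₁]

/-- Construction of a lift by induction on the degree. -/
theorem exists_lift_of_step {X Y Z W : J ⥤ M} (φ : X ⟶ Y) (ψ : Z ⟶ W) (τ : X ⟶ Z) (σ : Y ⟶ W)
    (step : ∀ (α : J) (l : ∀ β : J, deg β < deg α → (Y.obj β ⟶ Z.obj β)),
      (∀ β hβ, φ.app β ≫ l β hβ = τ.app β) → (∀ β hβ, l β hβ ≫ ψ.app β = σ.app β) →
      (∀ ⦃β γ : J⦄ (h : β ⟶ γ) (hβ : deg β < deg α) (hγ : deg γ < deg α),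
        Y.map h ≫ l γ hγ = l β hβ ≫ Z.map h) →
      ∃ t : Y.obj α ⟶ Z.obj α, φ.app α ≫ t = τ.app α ∧ t ≫ ψ.app α = σ.app α ∧
        (∀ ⦃β : J⦄ (h : β ⟶ α) (hh : dir h) (hn : ¬ MorphismProperty.identities J h),
          Y.map h ≫ t = l β (deg_lt_of_dir hh hn) ≫ Z.map h) ∧
        (∀ ⦃β : J⦄ (h : α ⟶ β) (hh : inv h) (hn : ¬ MorphismProperty.identities J h),
          Y.map h ≫ l β (deg_lt_of_inv hh hn) = t ≫ Z.map h)) :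
    ∃ l : Y ⟶ Z, φ ≫ l = τ ∧ l ≫ ψ = σ := by
  obtain ⟨l, hl⟩ := exists_forall_of_wellFounded
    (r := fun β γ : J => deg β < deg γ) (InvImage.wf _ wellFounded_lt) (fun h h' => h.trans h')
    (T := fun β => Y.obj β ⟶ Z.obj β)
    (P := fun α l t => φ.app α ≫ t = τ.app α ∧ t ≫ ψ.app α = σ.app α ∧
        (∀ ⦃β : J⦄ (h : β ⟶ α) (hh : dir h) (hn : ¬ MorphismProperty.identities J h),
          Y.map h ≫ t = l β (deg_lt_of_dir hh hn) ≫ Z.map h) ∧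
        (∀ ⦃β : J⦄ (h : α ⟶ β) (hh : inv h) (hn : ¬ MorphismProperty.identities J h),
          Y.map h ≫ l β (deg_lt_of_inv hh hn) = t ≫ Z.map h))
    (fun α l hl => step α l (fun β hβ => (hl β hβ).1) (fun β hβ => (hl β hβ).2.1)
      (naturality_of_dir_of_inv (deg α) l
        (fun β γ h hβ hγ hh hn => (hl γ hγ).2.2.1 h hh hn)
        (fun β γ h hβ hγ hh hn => (hl β hβ).2.2.2 h hh hn)))
  refine ⟨{ app := l, naturality := fun β γ h => ?_ }, NatTrans.ext (funext fun α => (hl α).1),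
    NatTrans.ext (funext fun α => (hl α).2.1)⟩
  -- The bound is strict, hence the successor of the maximum of the two degrees.
  exact naturality_of_dir_of_inv (max (deg β) (deg γ) + 1) (fun β _ => l β)
    (fun β γ h _ _ hh hn => (hl γ).2.2.1 h hh hn) (fun β γ h _ _ hh hn => (hl β).2.2.2 h hh hn) h
    (by simp) (by simp)

end Lifting

/-! ### Relative matching maps by duality, and the Reedy lifting argument -/

section Opposite

variable {A : Type u} [SmallCategory A] [ReedyCategory A] {M : Type w} [Category.{u} M]
  [HasLimits M]

theorem not_identities_op {C : Type*} [Category* C] {X Y : C} {f : X ⟶ Y}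
    (h : ¬ MorphismProperty.identities C f) : ¬ MorphismProperty.identities Cᵒᵖ f.op := by
  rwa [MorphismProperty.identities_op_iff]

theorem not_identities_unop {C : Type*} [Category* C] {X Y : Cᵒᵖ} {f : X ⟶ Y}
    (h : ¬ MorphismProperty.identities Cᵒᵖ f) : ¬ MorphismProperty.identities C f.unop := by
  rwa [MorphismProperty.identities_op_iff] at h

/-- The relative matching map at `op a` of a map of presheaves, obtained by duality. -/
noncomputable def relativeMatchingMap {Z W : Aᵒᵖ ⥤ M} (ψ : Z ⟶ W) (a : A) :
    Z.obj (op a) ⟶ (pushout (latchingMap W.rightOp a)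
      (latchingObjMap (NatTrans.rightOp ψ) a)).unop :=
  (relativeLatchingMap (NatTrans.rightOp ψ) a).unop

/-- A map whose relative latching maps lift against the relative matching maps of another one
lifts against it. -/
theorem hasLiftingProperty_of_latching_matching {X Y Z W : Aᵒᵖ ⥤ M} (φ : X ⟶ Y) (ψ : Z ⟶ W)
    (H : ∀ a : A, LatchingLift φ (op a) (relativeMatchingMap ψ a)) : HasLiftingProperty φ ψ := by
  refine ⟨fun {τ σ} sq => ?_⟩
  obtain ⟨l, h₁, h₂⟩ := exists_lift_of_step φ ψ τ σ (by
    rintro ⟨a⟩ l hφ hψ hnat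
    have hlt : ∀ β : LatchingCategory a, deg (op β.obj) < deg (op a) := fun β =>
      deg_lt_of_inv (h := β.hom.op) β.dir_hom (not_identities_op β.not_identity)
    -- `d.unop` is the map from `Y a` to the target `W a ×_{M_a W} M_a Z` of the relative matching
    -- map, given by `σ` and by the lifts already constructed in lower degree.
    obtain ⟨d, hd₁, hd₂⟩ := exists_relativeLatching_desc (NatTrans.rightOp ψ) a
      (E := op (Y.obj (op a))) (σ.app (op a)).op
      (fun β => (Y.map β.hom.op ≫ l (op β.obj) (hlt β)).op)
      (fun β γ f => Quiver.Hom.unop_inj (by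
        change (Y.map γ.hom.op ≫ l _ _) ≫ Z.map f.left.op = Y.map β.hom.op ≫ l _ _
        rw [Category.assoc, ← hnat, ← Y.map_comp_assoc, ← op_comp, f.w]))
      (fun β => Quiver.Hom.unop_inj (by
        change σ.app _ ≫ W.map β.hom.op = (Y.map β.hom.op ≫ l _ _) ≫ ψ.app _
        rw [Category.assoc, hψ, σ.naturality]))
    have key : ∀ {V : M} (f : V ⟶ Z.obj (op a)) (g : V ⟶ Y.obj (op a)),
        f ≫ ψ.app (op a) = g ≫ σ.app (op a) →
        (∀ β : LatchingCategory a,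
          f ≫ Z.map β.hom.op = g ≫ Y.map β.hom.op ≫ l (op β.obj) (hlt β)) →
        f ≫ relativeMatchingMap ψ a = g ≫ d.unop := by
      intro V f g h₁ h₂
      apply Quiver.Hom.op_inj
      change relativeLatchingMap (NatTrans.rightOp ψ) a ≫ f.op = d ≫ g.op
      apply relativeLatching_hom_ext
      · rw [inl_relativeLatchingMap_assoc, reassoc_of% hd₁]
        exact Quiver.Hom.unop_inj h₁
      · intro β
        rw [inr_relativeLatchingMap_assoc, reassoc_of% hd₂, ← Category.assoc, ι_latchingMap]
        refine Quiver.Hom.unop_inj ((h₂ β).trans ?_)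
        simp
    -- The lifts in lower degree also give a map on the latching object of `Y`. One lift of the
    -- relative latching map against the relative matching map then meets all four conditions.
    obtain ⟨t, ht₁, ht₂, ht₃⟩ := H a (τ.app (op a))
      (fun β => l β.obj (deg_lt_of_dir β.dir_hom β.not_identity) ≫ Z.map β.hom) d.unop
      (fun β γ f => by rw [reassoc_of% (hnat f.left), ← Z.map_comp, f.w])
      (fun β => by rw [reassoc_of% hφ, τ.naturality])
      (key _ _ (by
        have := NatTrans.congr_app sq.w (op a)
        exact this)
        (fun β => by rw [← τ.naturality, ← φ.naturality_assoc, hφ]))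
      (fun β => key _ _ (by rw [Category.assoc, ψ.naturality, reassoc_of% hψ, σ.naturality])
        (fun γ => by
          rw [Category.assoc, ← Z.map_comp, ← hnat _ _ (hlt γ), Y.map_comp, Category.assoc]))
    refine ⟨t, ht₁, ?_, fun β h hh hn => ht₂ ⟨β, h, hh, hn⟩, fun β h hh hn => ?_⟩
    · have := congrArg Quiver.Hom.op ht₃
      change relativeLatchingMap (NatTrans.rightOp ψ) a ≫ t.op = d at this
      rw [← this, inl_relativeLatchingMap_assoc] at hd₁
      exact Quiver.Hom.op_inj hd₁
    · have := congrArg Quiver.Hom.op ht₃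
      change relativeLatchingMap (NatTrans.rightOp ψ) a ≫ t.op = d at this
      have h' := hd₂ ⟨β.unop, h.unop, hh, not_identities_unop hn⟩
      rw [← this, inr_relativeLatchingMap_assoc, ← Category.assoc, ι_latchingMap] at h'
      exact (Quiver.Hom.op_inj h').symm)
  exact ⟨⟨⟨l, h₁, h₂⟩⟩⟩

/-- The lifting property of the relative matching map of `ψ` at `α` against `i`, without reference
to limits. -/
def MatchingLift {J : Type u} [SmallCategory J] [ReedyCategory J] {Z W : J ⥤ M} (ψ : Z ⟶ W)
    (α : J) {U V : M} (i : U ⟶ V) : Prop :=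
  ∀ (x : U ⟶ Z.obj α) (y : V ⟶ W.obj α)
    (v : ∀ ⦃β : J⦄ (g : α ⟶ β), inv g → ¬ MorphismProperty.identities J g → (V ⟶ Z.obj β)),
    (∀ ⦃β γ : J⦄ (g : α ⟶ β) (hg : inv g) (hg' : ¬ MorphismProperty.identities J g)
      (k : β ⟶ γ) (hk : inv k), v g hg hg' ≫ Z.map k =
        v (g ≫ k) (inv.comp_mem _ _ hg hk) (not_identities_comp_of_inv hg hk hg')) →
    (∀ ⦃β : J⦄ (g : α ⟶ β) (hg : inv g) (hg' : ¬ MorphismProperty.identities J g),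
      i ≫ v g hg hg' = x ≫ Z.map g ∧ v g hg hg' ≫ ψ.app β = y ≫ W.map g) →
    x ≫ ψ.app α = i ≫ y →
    ∃ l : V ⟶ Z.obj α, i ≫ l = x ∧ l ≫ ψ.app α = y ∧
      ∀ ⦃β : J⦄ (g : α ⟶ β) (hg : inv g) (hg' : ¬ MorphismProperty.identities J g),
        l ≫ Z.map g = v g hg hg'

/-- In `Mᵒᵖ` this is the lifting property of the relative latching map of `NatTrans.rightOp ψ`
against `i.op`, and `MatchingLift` is the transcription of its `LatchingLift`. -/
theorem hasLiftingProperty_relativeMatchingMap {Z W : Aᵒᵖ ⥤ M} (ψ : Z ⟶ W) (a : A) {U V : M}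
    (i : U ⟶ V) (H : MatchingLift ψ (op a) i) : HasLiftingProperty i (relativeMatchingMap ψ a) := by
  rw [HasLiftingProperty.iff_op]
  change HasLiftingProperty (relativeLatchingMap (NatTrans.rightOp ψ) a) i.op
  rw [hasLiftingProperty_relativeLatchingMap_iff]
  intro y v x hv hy hx hvx
  obtain ⟨l, h₁, h₂, h₃⟩ := H x.unop y.unop
    (fun β g hg hg' => (v ⟨β.unop, g.unop, hg, not_identities_unop hg'⟩).unop)
    (fun β γ g hg hg' k hk => congrArg Quiver.Hom.unop
      (hv (β := ⟨γ.unop, (g ≫ k).unop, (inv (A := Aᵒᵖ)).comp_mem _ _ hg hk,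
        not_identities_unop (not_identities_comp_of_inv hg hk hg')⟩)
        (γ := ⟨β.unop, g.unop, hg, not_identities_unop hg'⟩) ⟨k.unop, hk, rfl⟩))
    (fun β g hg hg' => ⟨congrArg Quiver.Hom.unop (hvx ⟨β.unop, g.unop, hg, not_identities_unop hg'⟩),
      congrArg Quiver.Hom.unop (hy ⟨β.unop, g.unop, hg, not_identities_unop hg'⟩).symm⟩)
    (congrArg Quiver.Hom.unop hx.symm)
  exact ⟨l.op, Quiver.Hom.unop_inj h₂,
    fun β => Quiver.Hom.unop_inj (h₃ β.hom.op β.dir_hom (not_identities_op β.not_identity)),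
    Quiver.Hom.unop_inj h₁⟩

end Opposite

end ReedyCategory

namespace ReedyCategory

/-! ### The boundary sieve of an object -/

section Boundary

variable {J : Type u} [SmallCategory J] [ReedyCategory J]

/-- The boundary of `γ`: the maps to `γ` that do not belong to the inverse subcategory, that is,
those that factor through a nonidentity direct map. -/
def boundary (γ : J) : Sieve γ where
  arrows _ k := ¬ inv k
  downward_closed {α β} k hk m hm := by
    -- `degHom` is the degree of the middle object of the Reedy factorization and cannot drop from
    -- `m ≫ k` to `k`. If `m ≫ k` is inverse it equals `deg γ`, which forces `k` to be inverse.
    refine hk ((reedyStructure J).prop₁_of_degHom_eq_deg_right (le_antisymm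
      ((reedyStructure J).degHom_le_deg_right k) ?_))
    have : (reedyStructure J).degHom (m ≫ k) = (reedyStructure J).deg γ :=
      (reedyStructure J).degHom_eq ⟨γ, m ≫ k, 𝟙 γ, by simp, hm, dir.id_mem γ⟩
    rw [← this]
    exact (reedyStructure J).degHom_comp_le_right m k

variable {α β γ : J}

theorem boundary_of_dir {d : β ⟶ γ} (hd : dir d) (hn : ¬ MorphismProperty.identities J d) :
    boundary γ d := fun hi => (deg_le_of_inv hi).not_gt (deg_lt_of_dir hd hn)

theorem not_identities_of_boundary {d : β ⟶ γ} (h : boundary γ d) :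
    ¬ MorphismProperty.identities J d := by
  intro hd
  obtain ⟨rfl, rfl⟩ := (identities_iff _).1 hd
  exact h (inv.id_mem _)

theorem boundary_comp_inv_iff {i : α ⟶ β} {d : β ⟶ γ} (hi : inv i) :
    boundary γ (i ≫ d) ↔ boundary γ d :=
  ⟨fun h hd => h (inv.comp_mem _ _ hi hd), fun h => (boundary γ).downward_closed h i⟩

end Boundary

/-! ### Coinduced diagrams and their version relative to a sieve -/

section Coinduced

variable {J : Type u} [SmallCategory J] {M : Type w} [Category.{u} M] [HasLimits M]
  {γ : J} (S : Sieve γ) {E B : M} (p : E ⟶ B)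

variable (γ E) in
/-- The coinduced diagram `β ↦ ∏_{β ⟶ γ} E`. -/
noncomputable def coinduced : J ⥤ M where
  obj β := ∏ᶜ fun _ : β ⟶ γ => E
  map m := Pi.lift fun k => Pi.π (fun _ => E) (m ≫ k)
  map_id β := Pi.hom_ext _ _ fun k => by simp
  map_comp m m' := Pi.hom_ext _ _ fun k => by simp

/-- The evaluation of the coinduced diagram at a map `β ⟶ γ`. -/
noncomputable def coinducedπ {β : J} (k : β ⟶ γ) : (coinduced γ E).obj β ⟶ E :=
  Pi.π (fun _ : β ⟶ γ => E) k

@[simp]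
theorem coinduced_map_π {α β : J} (m : α ⟶ β) (k : β ⟶ γ) :
    (coinduced γ E).map m ≫ coinducedπ k = coinducedπ (m ≫ k) :=
  Pi.lift_π _ _

@[simp]
theorem coinduced_map_π_assoc {α β : J} (m : α ⟶ β) (k : β ⟶ γ) {V : M} (f : E ⟶ V) :
    (coinduced γ E).map m ≫ coinducedπ k ≫ f = coinducedπ (m ≫ k) ≫ f := by
  rw [← Category.assoc, coinduced_map_π]

theorem coinduced_hom_ext {V : M} {β : J} {f g : V ⟶ (coinduced γ E).obj β}
    (h : ∀ k : β ⟶ γ, f ≫ coinducedπ k = g ≫ coinducedπ k) : f = g := Pi.hom_ext _ _ h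

/-- Maps into the objects of the coinduced diagram. -/
noncomputable def coinducedLift {V : M} {β : J} (e : (β ⟶ γ) → (V ⟶ E)) :
    V ⟶ (coinduced γ E).obj β := Pi.lift e

@[simp]
theorem coinducedLift_π {V : M} {β : J} (e : (β ⟶ γ) → (V ⟶ E)) (k : β ⟶ γ) :
    coinducedLift e ≫ coinducedπ k = e k := Pi.lift_π _ _

/-- The objects of the diagram `β ↦ (∏_{β ⟶ γ} B) ×_{∏_S B} (∏_S E)`. -/
noncomputable def relCoinducedObj (β : J) : M :=
  pullback (Pi.lift fun k : { k : β ⟶ γ // S k } => Pi.π (fun _ : β ⟶ γ => B) k.1)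
    (Limits.Pi.map fun _ : { k : β ⟶ γ // S k } => p)

namespace relCoinducedObj

/-- The `B`-valued component at `k`. -/
noncomputable def base {β : J} (k : β ⟶ γ) : relCoinducedObj S p β ⟶ B :=
  pullback.fst (Pi.lift fun k : { k : β ⟶ γ // S k } => Pi.π (fun _ : β ⟶ γ => B) k.1)
    (Limits.Pi.map fun _ : { k : β ⟶ γ // S k } => p) ≫ Pi.π (fun _ : β ⟶ γ => B) k

/-- The `E`-valued component at a member `k` of the sieve. -/
noncomputable def total {β : J} (k : β ⟶ γ) (hk : S k) : relCoinducedObj S p β ⟶ E :=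
  pullback.snd (Pi.lift fun k : { k : β ⟶ γ // S k } => Pi.π (fun _ : β ⟶ γ => B) k.1)
    (Limits.Pi.map fun _ : { k : β ⟶ γ // S k } => p) ≫
      Pi.π (fun _ : { k : β ⟶ γ // S k } => E) ⟨k, hk⟩

@[simp]
theorem total_comp {β : J} (k : β ⟶ γ) (hk : S k) : total S p k hk ≫ p = base S p k := by
  have := pullback.condition (f := Pi.lift fun k : { k : β ⟶ γ // S k } =>
    Pi.π (fun _ : β ⟶ γ => B) k.1) (g := Limits.Pi.map fun _ : { k : β ⟶ γ // S k } => p)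
    =≫ Pi.π _ ⟨k, hk⟩
  simp only [Category.assoc, Pi.lift_π, Pi.map_π] at this
  exact (Category.assoc _ _ _).trans this.symm

variable {S p} {V : M} {β : J}

theorem hom_ext {f g : V ⟶ relCoinducedObj S p β}
    (h : ∀ k : β ⟶ γ, f ≫ base S p k = g ≫ base S p k)
    (h' : ∀ (k : β ⟶ γ) (hk : S k), f ≫ total S p k hk = g ≫ total S p k hk) : f = g := by
  apply pullback.hom_ext
  · refine Pi.hom_ext _ _ fun k => ?_
    exact (Category.assoc _ _ _).trans ((h k).trans (Category.assoc _ _ _).symm)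
  · refine Pi.hom_ext _ _ fun k => ?_
    exact (Category.assoc _ _ _).trans ((h' k.1 k.2).trans (Category.assoc _ _ _).symm)

variable (b : (β ⟶ γ) → (V ⟶ B)) (e : ∀ k : β ⟶ γ, S k → (V ⟶ E)) (h : ∀ k hk, e k hk ≫ p = b k)

/-- Maps into the relative coinduced objects. -/
noncomputable def lift : V ⟶ relCoinducedObj S p β :=
  pullback.lift (Pi.lift b) (Pi.lift fun k => e k.1 k.2) (Pi.hom_ext _ _ fun k => by simp [h])

@[simp]
theorem lift_base (k : β ⟶ γ) : lift b e h ≫ base S p k = b k :=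
  (Category.assoc _ _ _).symm.trans ((pullback.lift_fst _ _ _ =≫ _).trans (Pi.lift_π _ _))

@[simp]
theorem lift_total (k : β ⟶ γ) (hk : S k) : lift b e h ≫ total S p k hk = e k hk :=
  (Category.assoc _ _ _).symm.trans ((pullback.lift_snd _ _ _ =≫ _).trans (Pi.lift_π _ _))

end relCoinducedObj

/-- The diagram `β ↦ (∏_{β ⟶ γ} B) ×_{∏_S B} (∏_S E)`. -/
noncomputable def relCoinduced : J ⥤ M where
  obj := relCoinducedObj S p
  map m := relCoinducedObj.lift (fun k => relCoinducedObj.base S p (m ≫ k))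
    (fun k hk => relCoinducedObj.total S p (m ≫ k) (S.downward_closed hk m)) (by simp)
  map_id β := relCoinducedObj.hom_ext (by simp) (by simp)
  map_comp m m' := relCoinducedObj.hom_ext (by simp) (by simp)

/-- The `B`-valued component at `k`. -/
noncomputable def relCoinducedBase {β : J} (k : β ⟶ γ) : (relCoinduced S p).obj β ⟶ B :=
  relCoinducedObj.base S p k

/-- The `E`-valued component at a member `k` of the sieve. -/
noncomputable def relCoinducedTotal {β : J} (k : β ⟶ γ) (hk : S k) :
    (relCoinduced S p).obj β ⟶ E := relCoinducedObj.total S p k hk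

@[simp]
theorem relCoinducedTotal_comp {β : J} (k : β ⟶ γ) (hk : S k) :
    relCoinducedTotal S p k hk ≫ p = relCoinducedBase S p k :=
  relCoinducedObj.total_comp S p k hk

variable {S p} in
theorem relCoinduced_hom_ext {V : M} {β : J} {f g : V ⟶ (relCoinduced S p).obj β}
    (h : ∀ k : β ⟶ γ, f ≫ relCoinducedBase S p k = g ≫ relCoinducedBase S p k)
    (h' : ∀ (k : β ⟶ γ) (hk : S k),
      f ≫ relCoinducedTotal S p k hk = g ≫ relCoinducedTotal S p k hk) : f = g :=
  relCoinducedObj.hom_ext h h'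

section

variable {V : M} {β : J} (b : (β ⟶ γ) → (V ⟶ B)) (e : ∀ k : β ⟶ γ, S k → (V ⟶ E))
  (h : ∀ k hk, e k hk ≫ p = b k)

/-- Maps into the objects of the relative coinduced diagram. -/
noncomputable def relCoinducedLift : V ⟶ (relCoinduced S p).obj β := relCoinducedObj.lift b e h

@[simp]
theorem relCoinducedLift_base (k : β ⟶ γ) :
    relCoinducedLift S p b e h ≫ relCoinducedBase S p k = b k :=
  relCoinducedObj.lift_base b e h k

@[simp]
theorem relCoinducedLift_total (k : β ⟶ γ) (hk : S k) :
    relCoinducedLift S p b e h ≫ relCoinducedTotal S p k hk = e k hk :=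
  relCoinducedObj.lift_total b e h k hk

end

@[simp]
theorem relCoinduced_map_base {α β : J} (m : α ⟶ β) (k : β ⟶ γ) :
    (relCoinduced S p).map m ≫ relCoinducedBase S p k = relCoinducedBase S p (m ≫ k) :=
  relCoinducedObj.lift_base (fun k => relCoinducedObj.base S p (m ≫ k))
    (fun k hk => relCoinducedObj.total S p (m ≫ k) (S.downward_closed hk m)) (by simp) k

@[simp]
theorem relCoinduced_map_total {α β : J} (m : α ⟶ β) (k : β ⟶ γ) (hk : S k) :
    (relCoinduced S p).map m ≫ relCoinducedTotal S p k hk =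
      relCoinducedTotal S p (m ≫ k) (S.downward_closed hk m) :=
  relCoinducedObj.lift_total (fun k => relCoinducedObj.base S p (m ≫ k))
    (fun k hk => relCoinducedObj.total S p (m ≫ k) (S.downward_closed hk m)) (by simp) k hk

/-- The canonical map from the coinduced diagram to the relative one. -/
noncomputable def coinducedMap : coinduced γ E ⟶ relCoinduced S p where
  app β := relCoinducedLift S p (fun k => coinducedπ k ≫ p) (fun k _ => coinducedπ k) (by simp)
  naturality α β m := relCoinduced_hom_ext (by simp) (by simp)

@[simp]
theorem coinducedMap_base {β : J} (k : β ⟶ γ) :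
    (coinducedMap S p).app β ≫ relCoinducedBase S p k = coinducedπ k ≫ p :=
  relCoinducedLift_base S p (fun k => coinducedπ k ≫ p) (fun k _ => coinducedπ k) (by simp) k

@[simp]
theorem coinducedMap_total {β : J} (k : β ⟶ γ) (hk : S k) :
    (coinducedMap S p).app β ≫ relCoinducedTotal S p k hk = coinducedπ k :=
  relCoinducedLift_total S p (fun k => coinducedπ k ≫ p) (fun k _ => coinducedπ k) (by simp) k hk

/-- Maps into the coinduced diagram. -/
noncomputable def toCoinduced {X : J ⥤ M} (x : X.obj γ ⟶ E) : X ⟶ coinduced γ E where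
  app β := coinducedLift fun k => X.map k ≫ x
  naturality α β m := coinduced_hom_ext fun k => by simp

@[simp]
theorem toCoinduced_π {X : J ⥤ M} (x : X.obj γ ⟶ E) {β : J} (k : β ⟶ γ) :
    (toCoinduced x).app β ≫ coinducedπ k = X.map k ≫ x :=
  coinducedLift_π _ _

theorem toCoinduced_π_assoc {X : J ⥤ M} (x : X.obj γ ⟶ E) {β : J} (k : β ⟶ γ) {V : M}
    (f : E ⟶ V) : (toCoinduced x).app β ≫ coinducedπ k ≫ f = X.map k ≫ x ≫ f := by
  rw [← Category.assoc, toCoinduced_π, Category.assoc]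

end Coinduced

/-! ### Latching and matching lifts for the coinduced map -/

section

variable {J : Type u} [SmallCategory J] [ReedyCategory J] {M : Type w} [Category.{u} M]
  [HasLimits M]

/-- The lifting property against `coinducedMap` detects the lifting property of the relative
latching map. -/
theorem latchingLift_of_hasLiftingProperty {X Y : J ⥤ M} (φ : X ⟶ Y) (γ : J) {E B : M}
    (p : E ⟶ B) [HasLiftingProperty φ (coinducedMap (boundary γ) p)] : LatchingLift φ γ p := by
  intro x v b hv hx hxb hvb
  -- The family `v` is given on nonidentity direct maps only. It extends to the boundary through the
  -- direct part of each map, and uniqueness of the factorization makes the extension well defined.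
  have main : ∀ ⦃β : J⦄ (k : β ⟶ γ) (_ : boundary γ k), ∃ e : Y.obj β ⟶ E,
      ∀ (δ : J) (i : β ⟶ δ) (d : δ ⟶ γ) (_ : inv i) (hd : dir d)
        (hn : ¬ MorphismProperty.identities J d), i ≫ d = k → e = Y.map i ≫ v ⟨δ, d, hd, hn⟩ := by
    intro β k hk
    obtain ⟨δ, i, d, hi, hd, rfl⟩ := exists_fac k
    have hn : ¬ MorphismProperty.identities J d :=
      not_identities_of_boundary ((boundary_comp_inv_iff hi).1 hk)
    refine ⟨Y.map i ≫ v ⟨δ, d, hd, hn⟩, fun δ' i' d' hi' hd' hn' h => ?_⟩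
    obtain ⟨rfl, rfl, rfl⟩ := fac_unique hi hd hi' hd' h.symm
    rw [← hv (β := ⟨δ, eqToHom rfl ≫ d', hd, hn⟩) (γ := ⟨δ, d', hd', hn'⟩)
      ⟨𝟙 δ, dir.id_mem _, by simp⟩]
    simp
  choose e he using main
  have fac : ∀ ⦃β : J⦄ (k : β ⟶ γ) (_ : boundary γ k), ∃ (i : LatchingCategory γ) (g : β ⟶ i.obj),
      inv g ∧ g ≫ i.hom = k := by
    intro β k hk
    obtain ⟨δ, i, d, hi, hd, rfl⟩ := exists_fac k
    exact ⟨⟨δ, d, hd, not_identities_of_boundary ((boundary_comp_inv_iff hi).1 hk)⟩, i, hi, rfl⟩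
  have he' : ∀ ⦃β : J⦄ (k : β ⟶ γ) (hk : boundary γ k) (i : LatchingCategory γ) (g : β ⟶ i.obj),
      inv g → g ≫ i.hom = k → e k hk = Y.map g ≫ v i := fun β k hk i g hg h =>
    he k hk i.obj g i.hom hg i.dir_hom i.not_identity h
  have hep : ∀ ⦃β : J⦄ (k : β ⟶ γ) (hk : boundary γ k), e k hk ≫ p = Y.map k ≫ b := by
    intro β k hk
    obtain ⟨i, g, hg, rfl⟩ := fac k hk
    rw [he' _ hk i g hg rfl, Category.assoc, hvb, Y.map_comp_assoc]
  have hφ : ∀ ⦃β : J⦄ (k : β ⟶ γ) (hk : boundary γ k), φ.app β ≫ e k hk = X.map k ≫ x := by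
    intro β k hk
    obtain ⟨i, g, hg, rfl⟩ := fac k hk
    rw [he' _ hk i g hg rfl, ← φ.naturality_assoc, ← hx, X.map_comp_assoc]
  -- Refactoring `m ≫ g` as `g'` followed by `d` gives the factorization of `m ≫ k`, with direct
  -- part `d ≫ i.hom`; compatibility of `v` along `d` concludes.
  have hmap : ∀ ⦃α β : J⦄ (m : α ⟶ β) (k : β ⟶ γ) (hk : boundary γ k),
      Y.map m ≫ e k hk = e (m ≫ k) ((boundary γ).downward_closed hk m) := by
    intro α β m k hk
    obtain ⟨i, g, hg, rfl⟩ := fac k hk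
    obtain ⟨δ, g', d, hg', hd, h⟩ := exists_fac (m ≫ g)
    have hn := not_identities_comp_of_dir hd i.dir_hom i.not_identity
    rw [he' _ hk i g hg rfl, he' _ _ ⟨δ, d ≫ i.hom, dir.comp_mem _ _ hd i.dir_hom, hn⟩ g' hg'
      (by rw [reassoc_of% h]), ← hv (β := ⟨δ, d ≫ i.hom, dir.comp_mem _ _ hd i.dir_hom, hn⟩)
      (γ := i) ⟨d, hd, rfl⟩]
    simp only [← Y.map_comp_assoc, h]
  let σ : Y ⟶ relCoinduced (boundary γ) p :=
    { app := fun β => relCoinducedLift _ _ (fun k => Y.map k ≫ b) (@e β) (@hep β)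
      naturality := fun α β m => relCoinduced_hom_ext (fun k => by simp)
        (fun k hk => by simp [hmap]) }
  have hσb : ∀ {β : J} (k : β ⟶ γ), σ.app β ≫ relCoinducedBase _ _ k = Y.map k ≫ b := fun k =>
    relCoinducedLift_base _ _ (fun k => Y.map k ≫ b) (@e _) (@hep _) k
  have hσe : ∀ {β : J} (k : β ⟶ γ) (hk : boundary γ k),
      σ.app β ≫ relCoinducedTotal _ _ k hk = e k hk := fun k hk =>
    relCoinducedLift_total _ _ (fun k => Y.map k ≫ b) (@e _) (@hep _) k hk
  have sq : CommSq (toCoinduced x) φ (coinducedMap (boundary γ) p) σ :=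
    ⟨NatTrans.ext (funext fun β => relCoinduced_hom_ext (fun k => by
        simp only [NatTrans.comp_app, Category.assoc, coinducedMap_base, toCoinduced_π_assoc,
          hσb, hxb, φ.naturality_assoc])
      (fun k hk => by
        simp only [NatTrans.comp_app, Category.assoc, coinducedMap_total, toCoinduced_π,
          hσe, hφ]))⟩
  have h₁ := NatTrans.congr_app sq.fac_left
  have h₂ := NatTrans.congr_app sq.fac_right
  -- The component at `𝟙 γ` recovers the lift, as in the adjunction between evaluation at `γ` and
  -- the coinduced diagram.
  refine ⟨sq.lift.app γ ≫ coinducedπ (𝟙 γ), ?_, fun β => ?_, ?_⟩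
  · rw [← Category.assoc, ← NatTrans.comp_app, h₁]
    simp
  · rw [sq.lift.naturality_assoc, coinduced_map_π, Category.comp_id]
    have hk : boundary γ β.hom := boundary_of_dir β.dir_hom β.not_identity
    rw [← coinducedMap_total (boundary γ) p β.hom hk, ← Category.assoc, ← NatTrans.comp_app, h₂,
      hσe, he' _ hk β (𝟙 _) (inv.id_mem _) (Category.id_comp _), Y.map_id, Category.id_comp]
  · rw [Category.assoc, ← coinducedMap_base (boundary γ), ← Category.assoc, ← NatTrans.comp_app, h₂,
      hσb, Y.map_id, Category.id_comp]

/-- The relative matching maps of `coinducedMap` lift against the maps against which `p` lifts. -/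
theorem matchingLift_coinducedMap (γ : J) {E B : M} (p : E ⟶ B) (α : J) {U V : M} (i : U ⟶ V)
    [HasLiftingProperty i p] : MatchingLift (coinducedMap (boundary γ) p) α i := by
  intro x y v hv hx hxy
  have main : ∀ k : α ⟶ γ, ∃ l : V ⟶ E, i ≫ l = x ≫ coinducedπ k ∧
      l ≫ p = y ≫ relCoinducedBase _ _ k ∧
      (∀ hk : boundary γ k, l = y ≫ relCoinducedTotal _ _ k hk) ∧
      ∀ ⦃β : J⦄ (g : α ⟶ β) (hg : inv g) (hg' : ¬ MorphismProperty.identities J g) (k' : β ⟶ γ),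
        g ≫ k' = k → l = v g hg hg' ≫ coinducedπ k' := by
    intro k
    have hxb : x ≫ coinducedπ k ≫ p = i ≫ y ≫ relCoinducedBase _ _ k := by
      rw [← reassoc_of% hxy, coinducedMap_base]
    obtain ⟨δ, j, d, hj, hd, rfl⟩ := exists_fac k
    by_cases hn : MorphismProperty.identities J j
    -- Here `k` is direct, so it does not factor through a nonidentity inverse map `g`: the inverse
    -- part of `g ≫ k'` would strictly lower the degree.
    · have hno : ∀ ⦃β : J⦄ (g : α ⟶ β) (hg : inv g) (hg' : ¬ MorphismProperty.identities J g)
          (k' : β ⟶ γ), g ≫ k' ≠ j ≫ d := by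
        intro β g hg hg' k' h
        obtain ⟨ε, j', d', hj', hd', rfl⟩ := exists_fac k'
        obtain ⟨rfl, hh, -⟩ := fac_unique (inv.comp_mem _ _ hg hj') hd' hj hd
          (by rw [Category.assoc, h])
        obtain ⟨rfl, -⟩ := (identities_iff _).1 hn
        exact ((deg_le_of_inv hj').trans_lt (deg_lt_of_inv hg hg')).false
      obtain ⟨rfl, rfl⟩ := (identities_iff _).1 hn
      simp only [eqToHom_refl, Category.id_comp] at hxb hno ⊢
      by_cases hdn : boundary γ d
      · refine ⟨y ≫ relCoinducedTotal _ _ d hdn, ?_, by simp, fun _ => rfl,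
          fun β g hg hg' k' h => (hno g hg hg' k' h).elim⟩
        rw [← reassoc_of% hxy, coinducedMap_total]
      -- Only here is a lift against `p` chosen: `d` is both direct and inverse, hence an identity.
      -- For every other `k` the component is forced by `y` or by `v`.
      · have sq : CommSq (x ≫ coinducedπ d) i p (y ≫ relCoinducedBase _ _ d) :=
          ⟨by rw [Category.assoc, hxb]⟩
        exact ⟨sq.lift, sq.fac_left, sq.fac_right, fun h => (hdn h).elim,
          fun β g hg hg' k' h => (hno g hg hg' k' h).elim⟩
    · refine ⟨v j hj hn ≫ coinducedπ d, ?_, ?_, fun hk => ?_, fun β g hg hg' k' h => ?_⟩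
      · rw [reassoc_of% (hx j hj hn).1, coinduced_map_π]
      · rw [Category.assoc, ← coinducedMap_base (boundary γ), reassoc_of% (hx j hj hn).2,
          relCoinduced_map_base]
      · rw [← coinducedMap_total (boundary γ) p d ((boundary_comp_inv_iff hj).1 hk),
          reassoc_of% (hx j hj hn).2, relCoinduced_map_total]
      · obtain ⟨ε, j', d', hj', hd', rfl⟩ := exists_fac k'
        obtain ⟨rfl, rfl, rfl⟩ := fac_unique (inv.comp_mem _ _ hg hj') hd' hj hd
          (by rw [Category.assoc, h])
        simp only [eqToHom_refl, Category.id_comp, Category.comp_id]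
        rw [← hv g hg hg' j' hj', Category.assoc, coinduced_map_π]
  choose l hl₁ hl₂ hl₃ hl₄ using main
  have hl : ∀ k, coinducedLift l ≫ coinducedπ k = l k := fun k => coinducedLift_π _ _
  refine ⟨coinducedLift l, coinduced_hom_ext fun k => ?_, relCoinduced_hom_ext (fun k => ?_)
    (fun k hk => ?_), fun β g hg hg' => coinduced_hom_ext fun k => ?_⟩
  · rw [Category.assoc, hl, hl₁]
  · rw [Category.assoc, coinducedMap_base, ← Category.assoc, hl, hl₂]
  · rw [Category.assoc, coinducedMap_total, hl, hl₃ k hk]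
  · rw [Category.assoc, coinduced_map_π, hl]
    exact hl₄ _ g hg hg' k rfl

end

end ReedyCategory

/-! ### Right adjoints in each variable -/

section TwoVariables

universe v₁ v₂ v₃ u₁ u₂ u₃

variable {C₁ : Type u₁} [Category.{v₁} C₁] {C₂ : Type u₂} [Category.{v₂} C₂]
  {C₃ : Type u₃} [Category.{v₃} C₃] (F : C₁ ⥤ C₂ ⥤ C₃)

/-- Pointwise right adjoints assemble into a bifunctor. -/
noncomputable def parametrizedRightAdjoint [∀ X, (F.obj X).IsLeftAdjoint] :
    C₁ᵒᵖ ⥤ C₃ ⥤ C₂ where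
  obj X := (F.obj X.unop).rightAdjoint
  map f := conjugateEquiv (Adjunction.ofIsLeftAdjoint _) (Adjunction.ofIsLeftAdjoint _)
    (F.map f.unop)
  map_id X := by simp
  map_comp f g := by simp

/-- Pointwise right adjoints give an adjunction with a parameter. -/
noncomputable def parametrizedAdjunctionOfIsLeftAdjoint [∀ X, (F.obj X).IsLeftAdjoint] :
    F ⊣₂ parametrizedRightAdjoint F where
  adj X := Adjunction.ofIsLeftAdjoint (F.obj X)
  unit_whiskerRight_map f := by
    ext Z
    exact (unit_conjugateEquiv (Adjunction.ofIsLeftAdjoint _) (Adjunction.ofIsLeftAdjoint _)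
      (F.map f) Z).symm

end TwoVariables

namespace ReedyCategory

section

variable (A : Type u) [SmallCategory A] (M : Type w) [Category.{u} M] [MonoidalCategory M]

/-- The exterior product with a fixed presheaf on the left, as an objectwise tensor product of
presheaves on `A × A`. -/
def exteriorProductObjIso (X : Aᵒᵖ ⥤ M) :
    (exteriorProduct A M).obj X ≅ (Functor.whiskeringLeft _ _ M).obj (CategoryTheory.Prod.snd A A).op ⋙
      tensorLeft ((CategoryTheory.Prod.fst A A).op ⋙ X) :=
  NatIso.ofComponents (fun Y => NatIso.ofComponents (fun a => Iso.refl _) (fun f => by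
    simp [MonoidalCategory.tensorHom_def, prodOpEquiv])) (fun f => by
    ext a
    simp only [NatTrans.comp_app]
    exact (Category.comp_id _).trans (Category.id_comp _).symm)

/-- The exterior product with a fixed presheaf on the right, as an objectwise tensor product of
presheaves on `A × A`. -/
def exteriorProductFlipObjIso (X : Aᵒᵖ ⥤ M) :
    (exteriorProduct A M).flip.obj X ≅ (Functor.whiskeringLeft _ _ M).obj (CategoryTheory.Prod.fst A A).op ⋙
      tensorRight ((CategoryTheory.Prod.snd A A).op ⋙ X) :=
  NatIso.ofComponents (fun Y => NatIso.ofComponents (fun a => Iso.refl _) (fun f => by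
    simp [MonoidalCategory.tensorHom_def, prodOpEquiv])) (fun f => by
    ext a
    simp only [NatTrans.comp_app]
    exact (Category.comp_id _).trans (Category.id_comp _).symm)

variable [HasLimits M] [SymmetricCategory M] [MonoidalClosed M]

/-- Restriction along the projection has a right Kan extension as right adjoint, and the objectwise
tensor product has the internal hom of the functor category, since `M` is closed and complete. -/
instance (X : Aᵒᵖ ⥤ M) : ((exteriorProduct A M).obj X).IsLeftAdjoint := by
  let := Functor.functorCategoryMonoidalClosed (A × A)ᵒᵖ M
  have := ((CategoryTheory.Prod.snd A A).op.ranAdjunction M).isLeftAdjoint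
  exact Functor.isLeftAdjoint_of_iso (exteriorProductObjIso A M X).symm

instance (X : Aᵒᵖ ⥤ M) : ((exteriorProduct A M).flip.obj X).IsLeftAdjoint := by
  let := Functor.functorCategoryMonoidalClosed (A × A)ᵒᵖ M
  have := ((CategoryTheory.Prod.fst A A).op.ranAdjunction M).isLeftAdjoint
  have : (tensorRight ((CategoryTheory.Prod.snd A A).op ⋙ X)).IsLeftAdjoint :=
    Functor.isLeftAdjoint_of_iso (BraidedCategory.tensorLeftIsoTensorRight _)
  exact Functor.isLeftAdjoint_of_iso (exteriorProductFlipObjIso A M X).symm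

variable [MonoidalCategory A] [HasColimits M]

instance (X : Aᵒᵖ ⥤ M) : ((dayConvolution A M).obj X).IsLeftAdjoint := by
  have := ((tensor A).op.lanAdjunction M).isLeftAdjoint
  exact inferInstanceAs (((exteriorProduct A M).obj X ⋙ (tensor A).op.lan).IsLeftAdjoint)

instance (X : Aᵒᵖ ⥤ M) : ((dayConvolution A M).flip.obj X).IsLeftAdjoint := by
  have := ((tensor A).op.lanAdjunction M).isLeftAdjoint
  exact inferInstanceAs (((exteriorProduct A M).flip.obj X ⋙ (tensor A).op.lan).IsLeftAdjoint)

/-- The adjunction of two variables of the Day convolution. -/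
noncomputable def dayConvolutionAdjunction :
    AdjunctionOfTwoVariables (dayConvolution A M)
      (parametrizedRightAdjoint (dayConvolution A M))
      (parametrizedRightAdjoint (dayConvolution A M).flip) where
  adjLeft := parametrizedAdjunctionOfIsLeftAdjoint _
  adjRight := parametrizedAdjunctionOfIsLeftAdjoint _

end

end ReedyCategory

/-! ### Pushout-products of relative latching maps -/

namespace ReedyCategory

section

variable {J : Type u} [SmallCategory J] [ReedyCategory J]
  {M : Type w} [Category.{u} M] [HasColimits M] {X Y : J ⥤ M} (φ : X ⟶ Y) (α : J)
  (F : M ⥤ M) [F.IsLeftAdjoint]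

/-- The map from `Y β` to the source of the relative latching map at `α`. -/
noncomputable def relativeLatchingIn (β : LatchingCategory α) :
    Y.obj β.obj ⟶ pushout (latchingMap X α) (latchingObjMap φ α) :=
  colimit.ι (latchingForget α ⋙ Y) β ≫ pushout.inr _ _

@[simp]
theorem relativeLatchingIn_comp (β : LatchingCategory α) :
    relativeLatchingIn φ α β ≫ relativeLatchingMap φ α = Y.map β.hom := by
  rw [relativeLatchingIn, Category.assoc, inr_relativeLatchingMap, ι_latchingMap]

/-- Maps out of the image of the source of the relative latching map by a left adjoint. -/
theorem exists_map_relativeLatching_desc {E : M} (x : F.obj (X.obj α) ⟶ E)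
    (v : ∀ β : LatchingCategory α, F.obj (Y.obj β.obj) ⟶ E)
    (hv : ∀ ⦃β γ : LatchingCategory α⦄ (f : β ⟶ γ), F.map (Y.map f.left) ≫ v γ = v β)
    (hx : ∀ β, F.map (X.map β.hom) ≫ x = F.map (φ.app β.obj) ≫ v β) :
    ∃ d : F.obj (pushout (latchingMap X α) (latchingObjMap φ α)) ⟶ E,
      F.map (pushout.inl _ _) ≫ d = x ∧ ∀ β, F.map (relativeLatchingIn φ α β) ≫ d = v β := by
  -- Transposition reduces to maps out of the pushout itself, so the preservation of colimits by `F`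
  -- need not be made explicit.
  let adj := Adjunction.ofIsLeftAdjoint F
  obtain ⟨d, hd, hd'⟩ := exists_relativeLatching_desc φ α (adj.homEquiv _ _ x)
    (fun β => adj.homEquiv _ _ (v β))
    (fun β γ f => by rw [← Adjunction.homEquiv_naturality_left, hv])
    (fun β => by rw [← Adjunction.homEquiv_naturality_left, hx,
      Adjunction.homEquiv_naturality_left])
  have hd'' : ∀ β, relativeLatchingIn φ α β ≫ d = adj.homEquiv _ _ (v β) := fun β =>
    (Category.assoc _ _ _).trans (hd' β)
  refine ⟨(adj.homEquiv _ _).symm d, ?_, fun β => ?_⟩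
  · rw [← Adjunction.homEquiv_naturality_left_symm, hd, Equiv.symm_apply_apply]
  · rw [← Adjunction.homEquiv_naturality_left_symm, hd'', Equiv.symm_apply_apply]

variable {α} in
theorem map_relativeLatching_hom_ext {E : M}
    {f g : F.obj (pushout (latchingMap X α) (latchingObjMap φ α)) ⟶ E}
    (h : F.map (pushout.inl _ _) ≫ f = F.map (pushout.inl _ _) ≫ g)
    (h' : ∀ β, F.map (relativeLatchingIn φ α β) ≫ f = F.map (relativeLatchingIn φ α β) ≫ g) :
    f = g := by
  let adj := Adjunction.ofIsLeftAdjoint F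
  apply (adj.homEquiv _ _).injective
  apply relativeLatching_hom_ext
  · rw [← Adjunction.homEquiv_naturality_left, h, Adjunction.homEquiv_naturality_left]
  · intro β
    refine (Category.assoc _ _ _).symm.trans (Eq.trans ?_ (Category.assoc _ _ _))
    change relativeLatchingIn φ α β ≫ _ = relativeLatchingIn φ α β ≫ _
    rw [← Adjunction.homEquiv_naturality_left, h', Adjunction.homEquiv_naturality_left]

variable [MonoidalCategory M] [MonoidalClosed M]

variable {α} in
theorem relativeLatching_whiskerLeft_hom_ext {T E : M}
    {f g : T ⊗ pushout (latchingMap X α) (latchingObjMap φ α) ⟶ E}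
    (h : T ◁ pushout.inl _ _ ≫ f = T ◁ pushout.inl _ _ ≫ g)
    (h' : ∀ β, T ◁ relativeLatchingIn φ α β ≫ f = T ◁ relativeLatchingIn φ α β ≫ g) : f = g :=
  map_relativeLatching_hom_ext φ (tensorLeft T) h h'

variable [SymmetricCategory M]

instance (T : M) : (tensorRight T).IsLeftAdjoint :=
  Functor.isLeftAdjoint_of_iso (BraidedCategory.tensorLeftIsoTensorRight T)

variable {α} in
theorem relativeLatching_whiskerRight_hom_ext {T E : M}
    {f g : pushout (latchingMap X α) (latchingObjMap φ α) ⊗ T ⟶ E}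
    (h : pushout.inl _ _ ▷ T ≫ f = pushout.inl _ _ ▷ T ≫ g)
    (h' : ∀ β, relativeLatchingIn φ α β ▷ T ≫ f = relativeLatchingIn φ α β ▷ T ≫ g) : f = g :=
  map_relativeLatching_hom_ext φ (tensorRight T) h h'

end

section

variable {J J' : Type u} [SmallCategory J] [ReedyCategory J] [SmallCategory J'] [ReedyCategory J']
  {M : Type w} [Category.{u} M] [HasColimits M] [MonoidalCategory M] [SymmetricCategory M]
  [MonoidalClosed M]

/-- The lifting property of the pushout-product of two relative latching maps, without reference to
colimits. -/
theorem exists_lift_of_pushoutProduct {X Y : J ⥤ M} (φ : X ⟶ Y) {X' Y' : J' ⥤ M} (ψ : X' ⟶ Y')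
    (α : J) (α' : J')
    (sq : (curriedTensor M).PushoutObjObj (relativeLatchingMap φ α) (relativeLatchingMap ψ α'))
    {E B : M} (p : E ⟶ B) [HasLiftingProperty sq.ι p]
    (x : Y.obj α ⊗ X'.obj α' ⟶ E) (x' : X.obj α ⊗ Y'.obj α' ⟶ E)
    (v : ∀ β : LatchingCategory α, Y.obj β.obj ⊗ Y'.obj α' ⟶ E)
    (v' : ∀ β' : LatchingCategory α', Y.obj α ⊗ Y'.obj β'.obj ⟶ E)
    (b : Y.obj α ⊗ Y'.obj α' ⟶ B)
    (hv : ∀ ⦃β γ : LatchingCategory α⦄ (f : β ⟶ γ), Y.map f.left ▷ _ ≫ v γ = v β)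
    (hv' : ∀ ⦃β γ : LatchingCategory α'⦄ (f : β ⟶ γ), _ ◁ Y'.map f.left ≫ v' γ = v' β)
    (hvv' : ∀ β β', Y.map β.hom ▷ _ ≫ v' β' = _ ◁ Y'.map β'.hom ≫ v β)
    (hxx' : φ.app α ▷ _ ≫ x = _ ◁ ψ.app α' ≫ x')
    (hxv : ∀ β, Y.map β.hom ▷ _ ≫ x = _ ◁ ψ.app α' ≫ v β)
    (hxv' : ∀ β', _ ◁ X'.map β'.hom ≫ x = _ ◁ ψ.app β'.obj ≫ v' β')
    (hx'v : ∀ β, X.map β.hom ▷ _ ≫ x' = φ.app β.obj ▷ _ ≫ v β)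
    (hx'v' : ∀ β', _ ◁ Y'.map β'.hom ≫ x' = φ.app α ▷ _ ≫ v' β')
    (hxb : x ≫ p = _ ◁ ψ.app α' ≫ b) (hx'b : x' ≫ p = φ.app α ▷ _ ≫ b)
    (hvb : ∀ β, v β ≫ p = Y.map β.hom ▷ _ ≫ b) (hvb' : ∀ β', v' β' ≫ p = _ ◁ Y'.map β'.hom ≫ b) :
    ∃ l : Y.obj α ⊗ Y'.obj α' ⟶ E, _ ◁ ψ.app α' ≫ l = x ∧ φ.app α ▷ _ ≫ l = x' ∧
      (∀ β, Y.map β.hom ▷ _ ≫ l = v β) ∧ (∀ β', _ ◁ Y'.map β'.hom ≫ l = v' β') ∧ l ≫ p = b := by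
  obtain ⟨d, hd, hdv⟩ : ∃ d : pushout (latchingMap X α) (latchingObjMap φ α) ⊗ Y'.obj α' ⟶ E,
      pushout.inl _ _ ▷ _ ≫ d = x' ∧ ∀ β, relativeLatchingIn φ α β ▷ _ ≫ d = v β :=
    exists_map_relativeLatching_desc φ α (tensorRight (Y'.obj α')) x' v hv hx'v
  obtain ⟨d', hd', hdv'⟩ : ∃ d : Y.obj α ⊗ pushout (latchingMap X' α') (latchingObjMap ψ α') ⟶ E,
      _ ◁ pushout.inl _ _ ≫ d = x ∧ ∀ β', _ ◁ relativeLatchingIn ψ α' β' ≫ d = v' β' :=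
    exists_map_relativeLatching_desc ψ α' (tensorLeft (Y.obj α)) x v' hv' hxv'
  -- Agreement on the common corner of the pushout-product is tested on four kinds of pieces, one
  -- for each choice of `X` or latching part in either factor. `hvv'` is the case of two latching
  -- parts.
  have hdd' : relativeLatchingMap φ α ▷ _ ≫ d' = _ ◁ relativeLatchingMap ψ α' ≫ d := by
    apply relativeLatching_whiskerRight_hom_ext φ
    · rw [← comp_whiskerRight_assoc, inl_relativeLatchingMap, ← whisker_exchange_assoc, hd]
      apply relativeLatching_whiskerLeft_hom_ext ψ
      · rw [whisker_exchange_assoc, hd', hxx', ← whiskerLeft_comp_assoc, inl_relativeLatchingMap]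
      · intro β'
        rw [whisker_exchange_assoc, hdv', ← hx'v', ← whiskerLeft_comp_assoc,
          relativeLatchingIn_comp]
    · intro β
      rw [← comp_whiskerRight_assoc, relativeLatchingIn_comp, ← whisker_exchange_assoc, hdv]
      apply relativeLatching_whiskerLeft_hom_ext ψ
      · rw [whisker_exchange_assoc, hd', hxv, ← whiskerLeft_comp_assoc, inl_relativeLatchingMap]
      · intro β'
        rw [whisker_exchange_assoc, hdv', hvv', ← whiskerLeft_comp_assoc,
          relativeLatchingIn_comp]
  have hdp : d ≫ p = relativeLatchingMap φ α ▷ _ ≫ b := by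
    apply relativeLatching_whiskerRight_hom_ext φ
    · rw [← comp_whiskerRight_assoc, inl_relativeLatchingMap, reassoc_of% hd, hx'b]
    · intro β
      rw [← comp_whiskerRight_assoc, relativeLatchingIn_comp, reassoc_of% (hdv β), hvb]
  have hdp' : d' ≫ p = _ ◁ relativeLatchingMap ψ α' ≫ b := by
    apply relativeLatching_whiskerLeft_hom_ext ψ
    · rw [← whiskerLeft_comp_assoc, inl_relativeLatchingMap, reassoc_of% hd', hxb]
    · intro β'
      rw [← whiskerLeft_comp_assoc, relativeLatchingIn_comp, reassoc_of% (hdv' β'), hvb']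
  have inl_ι : sq.inl ≫ sq.ι = _ ◁ relativeLatchingMap ψ α' := sq.inl_ι
  have inr_ι : sq.inr ≫ sq.ι = relativeLatchingMap φ α ▷ _ := sq.inr_ι
  have csq : CommSq (sq.isPushout.desc d' d hdd') sq.ι p b := ⟨by
    apply sq.hom_ext
    · rw [sq.isPushout.inl_desc_assoc, reassoc_of% inl_ι, hdp']
    · rw [sq.isPushout.inr_desc_assoc, reassoc_of% inr_ι, hdp]⟩
  obtain ⟨l, h₁, h₂, h₃⟩ : ∃ l : Y.obj α ⊗ Y'.obj α' ⟶ E, _ ◁ relativeLatchingMap ψ α' ≫ l = d' ∧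
      relativeLatchingMap φ α ▷ _ ≫ l = d ∧ l ≫ p = b :=
    ⟨csq.lift, by rw [← inl_ι, Category.assoc, csq.fac_left, sq.isPushout.inl_desc],
      by rw [← inr_ι, Category.assoc, csq.fac_left, sq.isPushout.inr_desc], csq.fac_right⟩
  refine ⟨l, ?_, ?_, fun β => ?_, fun β' => ?_, h₃⟩
  · rw [← hd', ← h₁, ← whiskerLeft_comp_assoc, inl_relativeLatchingMap]
  · rw [← hd, ← h₂, ← comp_whiskerRight_assoc, inl_relativeLatchingMap]
  · rw [← hdv, ← h₂, ← comp_whiskerRight_assoc, relativeLatchingIn_comp]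
  · rw [← hdv', ← h₁, ← whiskerLeft_comp_assoc, relativeLatchingIn_comp]

end

/-! ### Latching lifts of the exterior pushout-product -/

section Exterior

variable {A : Type u} [SmallCategory A] [ReedyCategory A]
  {M : Type w} [Category.{u} M] [HasColimits M] [MonoidalCategory M] [SymmetricCategory M]
  [MonoidalClosed M]

theorem identities_of_prod {C D : Type*} [Category* C] [Category* D] {X Y : (C × D)ᵒᵖ} {f : X ⟶ Y}
    (h : MorphismProperty.identities (C × D)ᵒᵖ f) :
    MorphismProperty.identities Cᵒᵖ f.unop.1.op ∧ MorphismProperty.identities Dᵒᵖ f.unop.2.op := by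
  obtain ⟨rfl, rfl⟩ := (identities_iff _).1 h
  exact ⟨(identities_iff _).2 ⟨rfl, rfl⟩, (identities_iff _).2 ⟨rfl, rfl⟩⟩

/-- The object of the latching category at `(a, a')` given by maps `β ⟶ a` and `β' ⟶ a'`. -/
abbrev latchingProd {a a' β β' : A} (f : op β ⟶ op a) (g : op β' ⟶ op a') (hf : dir f)
    (hg : dir g) (h : ¬ (MorphismProperty.identities Aᵒᵖ f ∧ MorphismProperty.identities Aᵒᵖ g)) :
    LatchingCategory (op (a, a')) where
  obj := op (β, β')
  hom := Quiver.Hom.op (X := (a, a')) (Y := (β, β')) (f.unop, g.unop)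
  dir_hom := ⟨hf, hg⟩
  not_identity hi := h (identities_of_prod hi)

/-- Morphisms between objects of the latching category at a pair. -/
abbrev latchingProdHom {a a' : A} {x y : LatchingCategory (op (a, a'))}
    (f : op x.obj.unop.1 ⟶ op y.obj.unop.1) (g : op x.obj.unop.2 ⟶ op y.obj.unop.2)
    (hf : dir f) (hg : dir g)
    (h : f ≫ y.hom.unop.1.op = x.hom.unop.1.op) (h' : g ≫ y.hom.unop.2.op = x.hom.unop.2.op) :
    x ⟶ y where
  left := Quiver.Hom.op (X := (y.obj.unop.1, y.obj.unop.2)) (Y := (x.obj.unop.1, x.obj.unop.2))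
    (f.unop, g.unop)
  dir_left := ⟨hf, hg⟩
  w := Quiver.Hom.unop_inj (Prod.ext (congrArg Quiver.Hom.unop h) (congrArg Quiver.Hom.unop h'))

/-- The object of the latching category at `(a, a')` given by one at `a`. -/
abbrev latchingLeft {a : A} (a' : A) (β : LatchingCategory (op a)) :
    LatchingCategory (op (a, a')) :=
  latchingProd β.hom (𝟙 (op a')) β.dir_hom (dir.id_mem _) fun h => β.not_identity h.1

/-- The object of the latching category at `(a, a')` given by one at `a'`. -/
abbrev latchingRight (a : A) {a' : A} (β : LatchingCategory (op a')) :
    LatchingCategory (op (a, a')) :=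
  latchingProd (𝟙 (op a)) β.hom (dir.id_mem _) β.dir_hom fun h => β.not_identity h.2

/-- The lifting property of the relative latching maps of an exterior pushout-product. -/
theorem latchingLift_exteriorProduct {X Y X' Y' : Aᵒᵖ ⥤ M} {i : X ⟶ Y} {j : X' ⟶ Y'}
    (sq : (exteriorProduct A M).PushoutObjObj i j) (a a' : A)
    (sqM : (curriedTensor M).PushoutObjObj (relativeLatchingMap i (op a))
      (relativeLatchingMap j (op a')))
    {E B : M} (p : E ⟶ B) [HasLiftingProperty sqM.ι p] :
    LatchingLift sq.ι (op (a, a')) p := by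
  intro x v b hv hx hxb hvb
  let x₁ : Y.obj (op a) ⊗ X'.obj (op a') ⟶ E := sq.inl.app (op (a, a')) ≫ x
  let x₂ : X.obj (op a) ⊗ Y'.obj (op a') ⟶ E := sq.inr.app (op (a, a')) ≫ x
  have hv₀ : ∀ ⦃β γ : LatchingCategory (op (a, a'))⦄ (f : β ⟶ γ),
      (Y.map f.left.unop.1.op ▷ Y'.obj (op β.obj.unop.2) ≫
        Y.obj (op γ.obj.unop.1) ◁ Y'.map f.left.unop.2.op) ≫ v γ = v β := hv
  have hinl : ∀ c : (A × A)ᵒᵖ, sq.inl.app c ≫ sq.ι.app c =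
      Y.obj (op c.unop.1) ◁ j.app (op c.unop.2) := fun c => NatTrans.congr_app sq.inl_ι c
  have hinr : ∀ c : (A × A)ᵒᵖ, sq.inr.app c ≫ sq.ι.app c =
      i.app (op c.unop.1) ▷ Y'.obj (op c.unop.2) := fun c => NatTrans.congr_app sq.inr_ι c
  have h₁ : ∀ β : LatchingCategory (op (a, a')),
      (Y.map β.hom.unop.1.op ▷ X'.obj (op β.obj.unop.2) ≫
        Y.obj (op a) ◁ X'.map β.hom.unop.2.op) ≫ x₁ =
        Y.obj (op β.obj.unop.1) ◁ j.app (op β.obj.unop.2) ≫ v β :=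
    fun β => (sq.inl.naturality_assoc β.hom x).trans
      ((congrArg (sq.inl.app β.obj ≫ ·) (hx β)).trans
        ((Category.assoc _ _ _).symm.trans (hinl β.obj =≫ v β)))
  have h₂ : ∀ β : LatchingCategory (op (a, a')),
      (X.map β.hom.unop.1.op ▷ Y'.obj (op β.obj.unop.2) ≫
        X.obj (op a) ◁ Y'.map β.hom.unop.2.op) ≫ x₂ =
        i.app (op β.obj.unop.1) ▷ Y'.obj (op β.obj.unop.2) ≫ v β :=
    fun β => (sq.inr.naturality_assoc β.hom x).trans
      ((congrArg (sq.inr.app β.obj ≫ ·) (hx β)).trans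
        ((Category.assoc _ _ _).symm.trans (hinr β.obj =≫ v β)))
  have h₃ : i.app (op a) ▷ X'.obj (op a') ≫ x₁ = X.obj (op a) ◁ j.app (op a') ≫ x₂ := by
    have := NatTrans.congr_app sq.isPushout.w (op (a, a')) =≫ x
    exact (Category.assoc _ _ _).symm.trans (this.trans (Category.assoc _ _ _))
  have hvb₀ : ∀ β : LatchingCategory (op (a, a')), v β ≫ p =
      (Y.map β.hom.unop.1.op ▷ Y'.obj (op β.obj.unop.2) ≫
        Y.obj (op a) ◁ Y'.map β.hom.unop.2.op) ≫ b := hvb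
  -- Restriction of `v` to the objects with one identity component. An object of the latching
  -- category at `(a, a')` has a nonidentity component, so `w` and `w'` determine `v` (`hw` and
  -- `hw'`).
  let w : ∀ β : LatchingCategory (op a), Y.obj β.obj ⊗ Y'.obj (op a') ⟶ E :=
    fun β => v (latchingLeft a' β)
  let w' : ∀ β : LatchingCategory (op a'), Y.obj (op a) ⊗ Y'.obj β.obj ⟶ E :=
    fun β => v (latchingRight a β)
  have hw : ∀ (x : LatchingCategory (op (a, a')))
      (h : ¬ MorphismProperty.identities _ x.hom.unop.1.op),
      Y.obj (op x.obj.unop.1) ◁ Y'.map x.hom.unop.2.op ≫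
        w ⟨op x.obj.unop.1, x.hom.unop.1.op, x.dir_hom.1, h⟩ = v x := by
    intro x h
    have : (Y.map (𝟙 (op x.obj.unop.1)) ▷ Y'.obj (op x.obj.unop.2) ≫
        Y.obj (op x.obj.unop.1) ◁ Y'.map x.hom.unop.2.op) ≫
        w ⟨op x.obj.unop.1, x.hom.unop.1.op, x.dir_hom.1, h⟩ = v x :=
      hv₀ (latchingProdHom (x := x)
        (y := latchingLeft a' ⟨op x.obj.unop.1, x.hom.unop.1.op, x.dir_hom.1, h⟩)
        (𝟙 _) x.hom.unop.2.op (dir.id_mem _) x.dir_hom.2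
        (Category.id_comp _) (Category.comp_id _))
    rwa [CategoryTheory.Functor.map_id, id_whiskerRight, Category.id_comp] at this
  have hw' : ∀ (x : LatchingCategory (op (a, a')))
      (h : ¬ MorphismProperty.identities _ x.hom.unop.2.op),
      Y.map x.hom.unop.1.op ▷ Y'.obj (op x.obj.unop.2) ≫
        w' ⟨op x.obj.unop.2, x.hom.unop.2.op, x.dir_hom.2, h⟩ = v x := by
    intro x h
    have : (Y.map x.hom.unop.1.op ▷ Y'.obj (op x.obj.unop.2) ≫
        Y.obj (op a) ◁ Y'.map (𝟙 (op x.obj.unop.2))) ≫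
        w' ⟨op x.obj.unop.2, x.hom.unop.2.op, x.dir_hom.2, h⟩ = v x :=
      hv₀ (latchingProdHom (x := x)
        (y := latchingRight a ⟨op x.obj.unop.2, x.hom.unop.2.op, x.dir_hom.2, h⟩)
        x.hom.unop.1.op (𝟙 _) x.dir_hom.1 (dir.id_mem _)
        (Category.comp_id _) (Category.id_comp _))
    rwa [CategoryTheory.Functor.map_id, whiskerLeft_id, Category.comp_id] at this
  have left : ∀ {P Q : Aᵒᵖ ⥤ M} (β : LatchingCategory (op a)),
      P.map β.hom ▷ Q.obj (op a') = P.map (latchingLeft a' β).hom.unop.1.op ▷ Q.obj (op a') ≫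
        P.obj (op a) ◁ Q.map (latchingLeft a' β).hom.unop.2.op := by
    intro P Q β
    change _ = P.map β.hom ▷ Q.obj (op a') ≫ P.obj (op a) ◁ Q.map (𝟙 (op a'))
    rw [CategoryTheory.Functor.map_id, whiskerLeft_id, Category.comp_id]
  have right : ∀ {P Q : Aᵒᵖ ⥤ M} (β : LatchingCategory (op a')),
      P.obj (op a) ◁ Q.map β.hom = P.map (latchingRight a β).hom.unop.1.op ▷ Q.obj β.obj ≫
        P.obj (op a) ◁ Q.map (latchingRight a β).hom.unop.2.op := by
    intro P Q β
    change _ = P.map (𝟙 (op a)) ▷ Q.obj β.obj ≫ P.obj (op a) ◁ Q.map β.hom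
    rw [CategoryTheory.Functor.map_id, id_whiskerRight, Category.id_comp]
  obtain ⟨l, hl₁, hl₂, hl₃, hl₄, hl₅⟩ := exists_lift_of_pushoutProduct i j (op a) (op a') sqM p
    x₁ x₂ w w' b
    (fun β γ f => by
      have : (Y.map f.left ▷ Y'.obj (op a') ≫ Y.obj γ.obj ◁ Y'.map (𝟙 (op a'))) ≫ w γ = w β :=
        hv₀ (latchingProdHom (x := latchingLeft a' β) (y := latchingLeft a' γ) f.left (𝟙 _)
          f.dir_left (dir.id_mem _) f.w (Category.id_comp _))
      rwa [CategoryTheory.Functor.map_id, whiskerLeft_id, Category.comp_id] at this)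
    (fun β γ f => by
      have : (Y.map (𝟙 (op a)) ▷ Y'.obj β.obj ≫ Y.obj (op a) ◁ Y'.map f.left) ≫ w' γ = w' β :=
        hv₀ (latchingProdHom (x := latchingRight a β) (y := latchingRight a γ) (𝟙 _) f.left
          (dir.id_mem _) f.dir_left (Category.id_comp _) f.w)
      rwa [CategoryTheory.Functor.map_id, id_whiskerRight, Category.id_comp] at this)
    (fun β β' => by
      let x := latchingProd β.hom β'.hom β.dir_hom β'.dir_hom fun h => β.not_identity h.1
      exact (hw' x β'.not_identity).trans (hw x β.not_identity).symm)
    h₃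
    (fun β => (left β =≫ x₁).trans (h₁ (latchingLeft a' β)))
    (fun β => (right β =≫ x₁).trans (h₁ (latchingRight a β)))
    (fun β => (left β =≫ x₂).trans (h₂ (latchingLeft a' β)))
    (fun β => (right β =≫ x₂).trans (h₂ (latchingRight a β)))
    ((Category.assoc _ _ _).trans ((congrArg (sq.inl.app (op (a, a')) ≫ ·) hxb).trans
      ((Category.assoc _ _ _).symm.trans (hinl (op (a, a')) =≫ b))))
    ((Category.assoc _ _ _).trans ((congrArg (sq.inr.app (op (a, a')) ≫ ·) hxb).trans
      ((Category.assoc _ _ _).symm.trans (hinr (op (a, a')) =≫ b))))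
    (fun β => (hvb₀ (latchingLeft a' β)).trans (left β =≫ b).symm)
    (fun β => (hvb₀ (latchingRight a β)).trans (right β =≫ b).symm)
  refine ⟨l, ?_, fun β => ?_, hl₅⟩
  -- Evaluation at `(a, a')` preserves the pushout, so the equality is tested on its two legs.
  · apply (sq.isPushout.map ((evaluation _ _).obj (op (a, a')))).hom_ext
    · refine Eq.trans ?_ hl₁
      refine (Category.assoc _ _ _).symm.trans ?_
      exact hinl (op (a, a')) =≫ l
    · refine Eq.trans ?_ hl₂
      refine (Category.assoc _ _ _).symm.trans ?_
      exact hinr (op (a, a')) =≫ l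
  · change (Y.map β.hom.unop.1.op ▷ Y'.obj (op β.obj.unop.2) ≫
      Y.obj (op a) ◁ Y'.map β.hom.unop.2.op) ≫ l = v β
    by_cases h : MorphismProperty.identities _ β.hom.unop.2.op
    · have h' : ¬ MorphismProperty.identities _ β.hom.unop.1.op := fun h' =>
        not_identities_unop β.not_identity (identities_prod _
          ((MorphismProperty.identities_op_iff _).1 h') ((MorphismProperty.identities_op_iff _).1 h))
      rw [← whisker_exchange, Category.assoc, ← hw β h']
      exact congrArg (_ ≫ ·) (hl₃ ⟨op β.obj.unop.1, β.hom.unop.1.op, β.dir_hom.1, h'⟩)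
    · rw [Category.assoc, ← hw' β h]
      exact congrArg (_ ≫ ·) (hl₄ ⟨op β.obj.unop.2, β.hom.unop.2.op, β.dir_hom.2, h⟩)

end Exterior

end ReedyCategory

namespace ReedyCategory

/-! ### Restriction of presheaves along a right fibration -/

section

variable {A B : Type u} [SmallCategory A] [SmallCategory B] [ReedyCategory A] [ReedyCategory B]
  {f : A ⥤ B} (hf : IsRightFibration.{w} f)
  {M : Type w} [Category.{u} M] [ModelCategory M] [HasLimits M] [HasColimits M]

include hf

/-- Restriction of presheaves along a right fibration preserves Reedy fibrations. -/
theorem fibrations_relativeMatchingMap_whiskerLeft {Z W : Bᵒᵖ ⥤ M} (ψ : Z ⟶ W)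
    (h : ∀ b, fibrations M (relativeMatchingMap ψ b)) (a : A) :
    fibrations M (relativeMatchingMap (Functor.whiskerLeft f.op ψ) a) :=
  -- Fibrations of `M` are cofibrations of `Mᵒᵖ`, and the relative matching maps of `ψ` are by
  -- definition the relative latching maps of `NatTrans.rightOp ψ`.
  (hf.isQuillenAdjunction Mᵒᵖ).map_cofibrations (NatTrans.rightOp ψ) h a

/-- Restriction of presheaves along a right fibration preserves Reedy trivial fibrations. -/
theorem trivialFibrations_relativeMatchingMap_whiskerLeft {Z W : Bᵒᵖ ⥤ M} (ψ : Z ⟶ W)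
    (h : ∀ b, trivialFibrations M (relativeMatchingMap ψ b)) (a : A) :
    trivialFibrations M (relativeMatchingMap (Functor.whiskerLeft f.op ψ) a) :=
  (trivialCofibrations_iff _).1 ((hf.isQuillenAdjunction Mᵒᵖ).map_trivialCofibrations
    (NatTrans.rightOp ψ) ((trivialCofibrations_iff _).2 h)) a

/-- The relative matching maps of the coinduced map inherit from `p` the lifting property that
defines trivial fibrations. Restriction along `f` keeps them trivial fibrations, and the Reedy
lifting argument applies on `A`. -/
theorem hasLiftingProperty_whiskerLeft_coinducedMap_of_cofibrations {X Y : Aᵒᵖ ⥤ M} (φ : X ⟶ Y)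
    (hφ : cofibrations _ φ) (γ : Bᵒᵖ) {E E' : M} (p : E ⟶ E') (hp : trivialFibrations M p) :
    HasLiftingProperty φ (Functor.whiskerLeft f.op (coinducedMap (boundary γ) p)) := by
  refine hasLiftingProperty_of_latching_matching _ _ fun a =>
    (cofibrations_iff_latchingLift φ).1 hφ (op a) _
      (trivialFibrations_relativeMatchingMap_whiskerLeft hf _ (fun b => ?_) a)
  rw [← cofibrations_rlp] at hp ⊢
  intro U V i hi
  have := hp i hi
  exact hasLiftingProperty_relativeMatchingMap _ _ _ (matchingLift_coinducedMap γ p (op b) i)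

theorem hasLiftingProperty_whiskerLeft_coinducedMap_of_trivialCofibrations {X Y : Aᵒᵖ ⥤ M}
    (φ : X ⟶ Y) (hφ : trivialCofibrations _ φ) (γ : Bᵒᵖ) {E E' : M} (p : E ⟶ E')
    (hp : fibrations M p) :
    HasLiftingProperty φ (Functor.whiskerLeft f.op (coinducedMap (boundary γ) p)) := by
  refine hasLiftingProperty_of_latching_matching _ _ fun a =>
    (trivialCofibrations_iff_latchingLift φ).1 hφ (op a) _
      (fibrations_relativeMatchingMap_whiskerLeft hf _ (fun b => ?_) a)
  rw [← trivialCofibrations_rlp] at hp ⊢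
  intro U V i hi
  have := hp i hi
  exact hasLiftingProperty_relativeMatchingMap _ _ _ (matchingLift_coinducedMap γ p (op b) i)

end

/-! ### The pushout-product axiom for the exterior product and for Day convolution -/

section

variable {A : Type u} [SmallCategory A] [ReedyCategory A] [MonoidalCategory A]
  {M : Type w} [Category.{u} M] [HasLimits M] [HasColimits M] [MonoidalCategory M]

/-- The pushout-product for the Day convolution is the left Kan extension of the exterior one. -/
theorem latchingLift_dayConvolution {X Y X' Y' : Aᵒᵖ ⥤ M} {i : X ⟶ Y} {j : X' ⟶ Y'}
    (sq : (dayConvolution A M).PushoutObjObj i j) (sqE : (exteriorProduct A M).PushoutObjObj i j)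
    (γ : Aᵒᵖ) {E B : M} (p : E ⟶ B)
    [H : HasLiftingProperty sqE.ι
      (Functor.whiskerLeft (tensor A).op (coinducedMap (boundary γ) p))] :
    LatchingLift sq.ι γ p := by
  have hlan : HasLiftingProperty ((tensor A).op.lan.map sqE.ι) (coinducedMap (boundary γ) p) :=
    (((tensor A).op.lanAdjunction M).hasLiftingProperty_iff _ _).2 H
  have := ((tensor A).op.lanAdjunction M).isLeftAdjoint
  -- A left adjoint preserves the pushout that defines the exterior pushout-product, which
  -- identifies `sq.ι` with the Kan extension of `sqE.ι` up to an isomorphism of sources.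
  have hpo : IsPushout (((dayConvolution A M).map i).app X') (((dayConvolution A M).obj X).map j)
      ((tensor A).op.lan.map sqE.inl) ((tensor A).op.lan.map sqE.inr) :=
    sqE.isPushout.map (tensor A).op.lan
  have e : sq.ι = (sq.isPushout.isoIsPushout _ _ hpo).hom ≫ (tensor A).op.lan.map sqE.ι := by
    apply sq.hom_ext
    · rw [sq.inl_ι, IsPushout.inl_isoIsPushout_hom_assoc, ← Functor.map_comp, sqE.inl_ι]
      rfl
    · rw [sq.inr_ι, IsPushout.inr_isoIsPushout_hom_assoc, ← Functor.map_comp, sqE.inr_ι]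
      rfl
  have : HasLiftingProperty sq.ι (coinducedMap (boundary γ) p) := by
    rw [e]
    infer_instance
  exact latchingLift_of_hasLiftingProperty sq.ι γ p

end

section

variable (A : Type u) [SmallCategory A] [ReedyCategory A]
  (M : Type w) [Category.{u} M] [ModelCategory M] [HasColimits M]
  [MonoidalCategory M] [SymmetricCategory M] [MonoidalClosed M]
  [SymmetricMonoidalModelCategory M]

/-- The exterior product satisfies the pushout-product axiom. -/
theorem pushoutProductAxiom_exteriorProduct : PushoutProductAxiom (exteriorProduct A M) where
  cofibration X Y i X' Y' j sq hi hj := by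
    rw [cofibrations_iff_latchingLift]
    intro α E B p hp
    let sqM := Functor.PushoutObjObj.ofHasPushout (curriedTensor M)
      (relativeLatchingMap i (op α.unop.1)) (relativeLatchingMap j (op α.unop.2))
    have h := SymmetricMonoidalModelCategory.pushoutProduct.cofibration _ _ sqM (hi _) (hj _)
    rw [← trivialFibrations_llp] at h
    have := h p hp
    exact latchingLift_exteriorProduct sq α.unop.1 α.unop.2 sqM p
  trivial_left X Y i X' Y' j sq hi hj := by
    rw [trivialCofibrations_iff_latchingLift]
    rw [trivialCofibrations_iff] at hi
    intro α E B p hp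
    let sqM := Functor.PushoutObjObj.ofHasPushout (curriedTensor M)
      (relativeLatchingMap i (op α.unop.1)) (relativeLatchingMap j (op α.unop.2))
    have h := SymmetricMonoidalModelCategory.pushoutProduct.trivial_left _ _ sqM (hi _) (hj _)
    rw [← fibrations_llp] at h
    have := h p hp
    exact latchingLift_exteriorProduct sq α.unop.1 α.unop.2 sqM p
  trivial_right X Y i X' Y' j sq hi hj := by
    rw [trivialCofibrations_iff_latchingLift]
    rw [trivialCofibrations_iff] at hj
    intro α E B p hp
    let sqM := Functor.PushoutObjObj.ofHasPushout (curriedTensor M)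
      (relativeLatchingMap i (op α.unop.1)) (relativeLatchingMap j (op α.unop.2))
    have h := SymmetricMonoidalModelCategory.pushoutProduct.trivial_right _ _ sqM (hi _) (hj _)
    rw [← fibrations_llp] at h
    have := h p hp
    exact latchingLift_exteriorProduct sq α.unop.1 α.unop.2 sqM p

/-- The Day convolution along a right fibration satisfies the pushout-product axiom. -/
theorem pushoutProductAxiom_dayConvolution [MonoidalCategory A] [HasLimits M]
    (hA : IsRightFibration.{w} (tensor A)) : PushoutProductAxiom (dayConvolution A M) where
  cofibration X Y i X' Y' j sq hi hj := by
    rw [cofibrations_iff_latchingLift]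
    intro γ E B p hp
    let sqE := Functor.PushoutObjObj.ofHasPushout (exteriorProduct A M) i j
    have := hasLiftingProperty_whiskerLeft_coinducedMap_of_cofibrations hA sqE.ι
      ((pushoutProductAxiom_exteriorProduct A M).cofibration _ _ sqE hi hj) γ p hp
    exact latchingLift_dayConvolution sq sqE γ p
  trivial_left X Y i X' Y' j sq hi hj := by
    rw [trivialCofibrations_iff_latchingLift]
    intro γ E B p hp
    let sqE := Functor.PushoutObjObj.ofHasPushout (exteriorProduct A M) i j
    have := hasLiftingProperty_whiskerLeft_coinducedMap_of_trivialCofibrations hA sqE.ι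
      ((pushoutProductAxiom_exteriorProduct A M).trivial_left _ _ sqE hi hj) γ p hp
    exact latchingLift_dayConvolution sq sqE γ p
  trivial_right X Y i X' Y' j sq hi hj := by
    rw [trivialCofibrations_iff_latchingLift]
    intro γ E B p hp
    let sqE := Functor.PushoutObjObj.ofHasPushout (exteriorProduct A M) i j
    have := hasLiftingProperty_whiskerLeft_coinducedMap_of_trivialCofibrations hA sqE.ι
      ((pushoutProductAxiom_exteriorProduct A M).trivial_right _ _ sqE hi hj) γ p hp
    exact latchingLift_dayConvolution sq sqE γ p

end

end ReedyCategory

theorem mainTheorem7 (A : Type u) [SmallCategory A] [ReedyCategory A] [MonoidalCategory A]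
    (hA : IsRightFibration.{w} (tensor A))
    (M : Type w) [Category.{u} M] [ModelCategory M] [HasLimits M] [HasColimits M]
    [MonoidalCategory M] [SymmetricCategory M] [MonoidalClosed M]
    [SymmetricMonoidalModelCategory M] :
    ∃ (G H : (Aᵒᵖ ⥤ M)ᵒᵖ ⥤ (Aᵒᵖ ⥤ M) ⥤ (Aᵒᵖ ⥤ M))
      (adj : AdjunctionOfTwoVariables (dayConvolution A M) G H), adj.IsQuillen :=
  ⟨_, _, ReedyCategory.dayConvolutionAdjunction A M,
    ReedyCategory.pushoutProductAxiom_dayConvolution A M hA⟩
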